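/- **Setting.** Let $m\ge 1$ and $0=l^0<l^1<\dots<l^m=L$, and put $h_j=l^j-l^{j-1}$. On each beam $(l^{j-1},l^j)$ let $\rho$ and $EI$ be real-valued, Lipschitz continuous and uniformly positive. Their one-sided limits at the nodes exist; they may be discontinuous at the junctions $l^1,\dots,l^{m-1}$. For $\zeta\in[0,1]$ put $$\mathcal H^j(\zeta)=\operatorname{diag}\big(\mathcal H^j_1,\mathcal H^j_2\big)(\zeta)=\operatorname{diag}\big(\rho^{-1},EI\big)\big((1-\zeta)l^{j-1}+\zeta l^j\big),$$ where one-sided limits are taken at $\zeta=0,1$, and $\mathcal H=\operatorname{diag}(\mathcal H^1,\dots,\mathcal H^m)$. Assume the jump condition $$\mathcal H^{j+1}(0)-\mathcal H^j(1)\ \text{ is positive semidefinite},\qquad j=1,\dots,m-1 .$$ Let $X=L_2(0,1;\mathbb C^{2m})\ni x=(x^1,\dots,x^m)$, $x^j=(x^j_1,x^j_2)$, with the energy norm $\|x\|_X^2=\int_0^1\langle x,\mathcal Hx\rangle\,d\zeta$. Let $D(\mathfrak A)=\{x\in X:\mathcal Hx\in H^2(0,1;\mathbb C^{2m})\}$ and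 $$(\mathfrak A x)^j=h_j^{-2}\begin{pmatrix}0&-1\\1&0\end{pmatrix}(\mathcal H^jx^j)'',\qquad j=1,\dots,m.$$ **Traces.** For $x\in D(\mathfrak A)$ and $s\in\{0,1\}$ write $v^j(s)=(\mathcal H^j_1x^j_1)(s)$ and $M^j(s)=(\mathcal H^j_2x^j_2)(s)$ (the one-sided limits of $\omega_t$ and $EI\,\omega_{\zeta\zeta}$), and $\dot v^j(s)=h_j^{-1}(\mathcal H^j_1x^j_1)'(s)$ and $\dot M^j(s)=h_j^{-1}(\mathcal H^j_2x^j_2)'(s)$ (the one-sided limits of $\omega_{t\zeta}$ and $(EI\,\omega_{\zeta\zeta})_\zeta$). For $f\in\{v,M,\dot v,\dot M\}$ let $[f]_j=f^j(1)-f^{j+1}(0)$ be the jump at the junction $j\in\{1,\dots,m-1\}$. **Junction and boundary maps.** For each junction $j=1,\dots,m-1$ choose one of the four cases $$\begin{array}{lll} (1)&\mathfrak B_0^jx=([v]_j,[\dot v]_j),&\mathfrak B^jx=(-[\dot M]_j,[M]_j),\\ (2)&\mathfrak B_0^jx=([v]_j,[M]_j),&\mathfrak B^jx=(-[\dot M]_j,[\dot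 v]_j),\\ (3)&\mathfrak B_0^jx=(-[\dot M]_j,[\dot v]_j),&\mathfrak B^jx=([v]_j,[M]_j),\\ (4)&\mathfrak B_0^jx=(-[\dot M]_j,[M]_j),&\mathfrak B^jx=([v]_j,[\dot v]_j). \end{array}$$ Given matrices $W_B^0,W_B^m\in\mathbb C^{2\times4}$, put $$\mathfrak B^0x=W_B^0\,(v^1,M^1,-\dot M^1,\dot v^1)^{\!\top}(0),\qquad \mathfrak B^mx=W_B^m\,(v^m,M^m,\dot M^m,-\dot v^m)^{\!\top}(1),$$ and $\mathfrak B=(\mathfrak B^0,\dots,\mathfrak B^m)$. Let $\mathfrak A_0$ be the restriction of $\mathfrak A$ to $D(\mathfrak A_0)=\bigcap_{j=1}^{m-1}\ker\mathfrak B_0^j$. Let $\mathfrak R:D(\mathfrak A_0)\to\mathbb C^5$ be any of the eight maps $$\mathfrak Rx=\Big(v^1(0),\ M^1(0),\ \dot v^1(0)\text{ or }\dot M^1(0),\ v^m(1)\text{ or }\dot M^m(1),\ \dot v^m(1)\text{ or }M^m(1)\Big).$$ **Proposition 3.6.** The pair $(\mathfrak A_0,(\mathfrak R,\mathfrak B))$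 has property AIEP: for every sequence $(x_n,\beta_n)_{n}\subseteq D(\mathfrak A_0)\times\mathbb R$ with $$\sup_n\|x_n\|_X<\infty,\quad |\beta_n|\to\infty,\quad (\mathfrak A_0-i\beta_n)x_n\to0\ \text{in }X,\quad \mathfrak Rx_n\to0,\quad \mathfrak Bx_n\to0,$$ it follows that $\|x_n\|_{L_2}\to0$. -/

import Mathlib

open MeasureTheory Set Filter Topology

/-- Which two of the four quantities `ω_t`, `ω_{tζ}`, `EI ω_{ζζ}`, `(EI ω_{ζζ})_ζ` are required to be
continuous at a junction: one of the dual pair `ω_t`, `(EI ω_{ζζ})_ζ` and one of the dual pair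
`ω_{tζ}`, `EI ω_{ζζ}`. -/
inductive JunctionType
  /-- `ω_t` and `ω_{tζ}` are continuous. -/
  | velocityAngular
  /-- `ω_t` and `EI ω_{ζζ}` are continuous. -/
  | velocityMoment
  /-- `(EI ω_{ζζ})_ζ` and `ω_{tζ}` are continuous. -/
  | shearAngular
  /-- `(EI ω_{ζζ})_ζ` and `EI ω_{ζζ}` are continuous. -/
  | shearMoment

/-- A serial chain of `m = n + 1` beams: beam `j` occupies `(node j, node (j + 1))`, and junction
`k : Fin n` joins beam `k` and beam `k + 1` (all indices start at `0`).  `ρ j` and `EI j` are the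
parameters of beam `j` as functions of the physical position, `WB₀`, `WBm` are the matrices of the
boundary control maps at the left and the right end of the chain. -/
structure BeamChain (n : ℕ) where
  node : Fin (n + 2) → ℝ
  node_zero : node 0 = 0
  node_strictMono : StrictMono node
  ρ : Fin (n + 1) → ℝ → ℝ
  EI : Fin (n + 1) → ℝ → ℝ
  junction : Fin n → JunctionType
  WB₀ : Matrix (Fin 2) (Fin 4) ℂ
  WBm : Matrix (Fin 2) (Fin 4) ℂ

/-- `L²(0,1; ℂ^{2m})` with `m = n + 1`; the coordinate `(j, 0)` is `x^j_1` and `(j, 1)` is `x^j_2`. -/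
abbrev BeamSpace (n : ℕ) : Type :=
  Lp (EuclideanSpace ℂ (Fin (n + 1) × Fin 2)) 2 (volume.restrict (Ioo (0 : ℝ) 1))

/-- `u` restricted to `[0,1]` is the absolutely continuous representative of a function in the Sobolev
space `H¹(0,1)`, and `v` is (a representative of) its derivative. -/
structure IsSobolevPrimitive (u v : ℝ → ℂ) : Prop where
  memLp : MemLp v 2 (volume.restrict (Ioo (0 : ℝ) 1))
  eq_integral : ∀ t ∈ Icc (0 : ℝ) 1, u t = u 0 + ∫ s in (0 : ℝ)..t, v s

namespace IsSobolevPrimitive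

theorem intervalIntegrable {u v : ℝ → ℂ} (h : IsSobolevPrimitive u v) :
    IntervalIntegrable v volume 0 1 := by
  rw [intervalIntegrable_iff_integrableOn_Ioo_of_le zero_le_one]
  exact h.memLp.integrable (by norm_num)

theorem continuousOn {u v : ℝ → ℂ} (h : IsSobolevPrimitive u v) :
    ContinuousOn u (Icc 0 1) := by
  have h1 : ContinuousOn (fun t => u 0 + ∫ s in (0 : ℝ)..t, v s) (Icc 0 1) := by
    refine continuousOn_const.add ?_
    have h2 := intervalIntegral.continuousOn_primitive_interval' h.intervalIntegrable
      (left_mem_uIcc)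
    rwa [uIcc_of_le zero_le_one] at h2
  exact h1.congr h.eq_integral

theorem add {u v u' v' : ℝ → ℂ} (h : IsSobolevPrimitive u v) (h' : IsSobolevPrimitive u' v') :
    IsSobolevPrimitive (fun t => u t + u' t) (fun t => v t + v' t) where
  memLp := h.memLp.add h'.memLp
  eq_integral t ht := by
    have hs : uIcc 0 t ⊆ uIcc (0 : ℝ) 1 := by
      rw [uIcc_of_le ht.1, uIcc_of_le zero_le_one]
      exact Icc_subset_Icc_right ht.2
    rw [intervalIntegral.integral_add (h.intervalIntegrable.mono_set hs)
      (h'.intervalIntegrable.mono_set hs), h.eq_integral t ht, h'.eq_integral t ht]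
    ring

theorem const_mul {u v : ℝ → ℂ} (c : ℂ) (h : IsSobolevPrimitive u v) :
    IsSobolevPrimitive (fun t => c * u t) (fun t => c * v t) where
  memLp := h.memLp.const_mul c
  eq_integral t ht := by
    rw [intervalIntegral.integral_const_mul, h.eq_integral t ht]
    ring

/-- A function vanishing almost everywhere has vanishing representative and derivative. -/
theorem eq_zero {u v : ℝ → ℂ} (h : IsSobolevPrimitive u v)
    (hu : ∀ᵐ t ∂(volume.restrict (Ioo (0 : ℝ) 1)), u t = 0) :
    (∀ t ∈ Icc (0 : ℝ) 1, u t = 0) ∧ ∀ᵐ t ∂(volume.restrict (Ioo (0 : ℝ) 1)), v t = 0 := by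
  have h0 : ∀ t ∈ Icc (0 : ℝ) 1, u t = 0 := by
    have hu' : u =ᵐ[volume.restrict (Icc (0 : ℝ) 1)] fun _ => (0 : ℂ) := by
      rwa [restrict_Ioo_eq_restrict_Icc] at hu
    exact Measure.eqOn_Icc_of_ae_eq volume zero_ne_one hu' h.continuousOn continuousOn_const
  refine ⟨h0, ?_⟩
  have hd := h.intervalIntegrable.ae_hasDerivAt_integral
  rw [ae_restrict_iff' measurableSet_Ioo]
  filter_upwards [hd] with t ht htI
  have ht' := ht (by rw [uIcc_of_le zero_le_one]; exact Ioo_subset_Icc_self htI) 0 left_mem_uIcc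
  have hz : (fun x => ∫ s in (0 : ℝ)..x, v s) =ᶠ[𝓝 t] fun _ => (0 : ℂ) := by
    filter_upwards [Ioo_mem_nhds htI.1 htI.2] with x hx
    have := h.eq_integral x (Ioo_subset_Icc_self hx)
    rw [h0 x (Ioo_subset_Icc_self hx), h0 0 (by simp), zero_add] at this
    exact this.symm
  exact (ht'.congr_of_eventuallyEq hz.symm).unique (hasDerivAt_const t (0 : ℂ))

end IsSobolevPrimitive

namespace BeamChain

variable {n : ℕ} (c : BeamChain n)

/-- The length `l^j - l^{j-1}` of beam `j`. -/
noncomputable def len (j : Fin (n + 1)) : ℝ := c.node j.succ - c.node j.castSucc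

/-- The diagonal entries of `𝓗^j` on the reference interval `[0,1]`: `1/ρ` and `EI`, evaluated at
`(1 - ζ) l^{j-1} + ζ l^j`. -/
noncomputable def H (j : Fin (n + 1)) (i : Fin 2) (ζ : ℝ) : ℝ :=
  ![(c.ρ j ((1 - ζ) * c.node j.castSucc + ζ * c.node j.succ))⁻¹,
    c.EI j ((1 - ζ) * c.node j.castSucc + ζ * c.node j.succ)] i

/-- The matrix `𝓗^j(ζ)`. -/
noncomputable def HMat (j : Fin (n + 1)) (ζ : ℝ) : Matrix (Fin 2) (Fin 2) ℝ :=
  Matrix.diagonal fun i => c.H j i ζ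

/-- Regularity: on every beam `ρ` and `EI` are Lipschitz continuous and uniformly positive.  Lipschitz
functions on the open interval are identified with their continuous extensions to the closed one. -/
def Regular : Prop :=
  ∀ j, (∃ K, LipschitzOnWith K (c.ρ j) (Icc (c.node j.castSucc) (c.node j.succ))) ∧
    (∃ K, LipschitzOnWith K (c.EI j) (Icc (c.node j.castSucc) (c.node j.succ))) ∧
    ∃ ε > 0, ∀ z ∈ Icc (c.node j.castSucc) (c.node j.succ), ε ≤ c.ρ j z ∧ ε ≤ c.EI j z

/-- Jump condition: at every junction `𝓗^{j+1}(0) - 𝓗^j(1)` is positive semidefinite. -/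
def JumpCondition : Prop :=
  ∀ k : Fin n, (c.HMat k.succ 0 - c.HMat k.castSucc 1).PosSemidef

/-- The energy norm `(∫₀¹ ⟨x(ζ), 𝓗(ζ) x(ζ)⟩ dζ)^{1/2}`. -/
noncomputable def energyNorm (x : BeamSpace n) : ℝ :=
  √(∫ ζ in Ioo (0 : ℝ) 1, ∑ j, ∑ i, c.H j i ζ * ‖x ζ (j, i)‖ ^ 2)

/-- `𝓗 x` belongs to `H²(0,1; ℂ^{2m})`; `u` is its `C¹` representative on `[0,1]`, `u₁` the derivative
of that representative and `u₂` its second (weak) derivative. -/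
structure IsEffort (x : BeamSpace n) (u u₁ u₂ : Fin (n + 1) → Fin 2 → ℝ → ℂ) : Prop where
  ae_eq : ∀ j i, ∀ᵐ ζ ∂(volume.restrict (Ioo (0 : ℝ) 1)), u j i ζ = (c.H j i ζ : ℂ) * x ζ (j, i)
  first : ∀ j i, IsSobolevPrimitive (u j i) (u₁ j i)
  second : ∀ j i, IsSobolevPrimitive (u₁ j i) (u₂ j i)

theorem IsEffort.add {c : BeamChain n} {x y : BeamSpace n}
    {u u₁ u₂ v v₁ v₂ : Fin (n + 1) → Fin 2 → ℝ → ℂ}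
    (h : c.IsEffort x u u₁ u₂) (h' : c.IsEffort y v v₁ v₂) :
    c.IsEffort (x + y) (fun j i t => u j i t + v j i t) (fun j i t => u₁ j i t + v₁ j i t)
      (fun j i t => u₂ j i t + v₂ j i t) where
  ae_eq j i := by
    filter_upwards [h.ae_eq j i, h'.ae_eq j i, Lp.coeFn_add x y] with t h1 h2 h3
    rw [h1, h2, h3]
    simp [mul_add]
  first j i := (h.first j i).add (h'.first j i)
  second j i := (h.second j i).add (h'.second j i)

theorem IsEffort.smul {c : BeamChain n} {x : BeamSpace n}
    {u u₁ u₂ : Fin (n + 1) → Fin 2 → ℝ → ℂ} (a : ℂ) (h : c.IsEffort x u u₁ u₂) :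
    c.IsEffort (a • x) (fun j i t => a * u j i t) (fun j i t => a * u₁ j i t)
      (fun j i t => a * u₂ j i t) where
  ae_eq j i := by
    filter_upwards [h.ae_eq j i, Lp.coeFn_smul a x] with t h1 h3
    rw [h1, h3]
    simp only [Pi.smul_apply, PiLp.smul_apply, smul_eq_mul]
    ring
  first j i := (h.first j i).const_mul a
  second j i := (h.second j i).const_mul a

/-- The representative, its derivative and its second derivative are determined by `x`. -/
theorem IsEffort.unique {c : BeamChain n} {x : BeamSpace n}
    {u u₁ u₂ v v₁ v₂ : Fin (n + 1) → Fin 2 → ℝ → ℂ}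
    (h : c.IsEffort x u u₁ u₂) (h' : c.IsEffort x v v₁ v₂) (j : Fin (n + 1)) (i : Fin 2) :
    (∀ t ∈ Icc (0 : ℝ) 1, u j i t = v j i t) ∧ (∀ t ∈ Icc (0 : ℝ) 1, u₁ j i t = v₁ j i t) ∧
      ∀ᵐ t ∂(volume.restrict (Ioo (0 : ℝ) 1)), u₂ j i t = v₂ j i t := by
  have e1 := (h.first j i).add ((h'.first j i).const_mul (-1))
  have e2 := (h.second j i).add ((h'.second j i).const_mul (-1))
  obtain ⟨z0, z1⟩ := e1.eq_zero (by
    filter_upwards [h.ae_eq j i, h'.ae_eq j i] with t h1 h2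
    rw [h1, h2]; ring)
  obtain ⟨z2, z3⟩ := e2.eq_zero z1
  refine ⟨fun t ht => ?_, fun t ht => ?_, ?_⟩
  · linear_combination z0 t ht
  · linear_combination z2 t ht
  · filter_upwards [z3] with t ht
    linear_combination ht

/-- `D(𝔄) = {x ∈ L²(0,1; ℂ^{2m}) : 𝓗 x ∈ H²(0,1; ℂ^{2m})}`. -/
def maxDomain : Submodule ℂ (BeamSpace n) where
  carrier := {x | ∃ u u₁ u₂, c.IsEffort x u u₁ u₂}
  add_mem' := by
    rintro x y ⟨u, u₁, u₂, h⟩ ⟨v, v₁, v₂, h'⟩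
    exact ⟨_, _, _, h.add h'⟩
  zero_mem' := by
    refine ⟨fun _ _ _ => 0, fun _ _ _ => 0, fun _ _ _ => 0, ?_, ?_, ?_⟩
    · intro j i
      filter_upwards [Lp.coeFn_zero (EuclideanSpace ℂ (Fin (n + 1) × Fin 2)) 2
        (volume.restrict (Ioo (0 : ℝ) 1))] with t ht
      rw [ht]; simp
    · exact fun _ _ => ⟨MemLp.zero, by simp⟩
    · exact fun _ _ => ⟨MemLp.zero, by simp⟩
  smul_mem' := by
    rintro a x ⟨u, u₁, u₂, h⟩
    exact ⟨_, _, _, h.smul a⟩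

/-- The `C¹` representative of `𝓗 x` on `[0,1]`. -/
noncomputable def effort (x : c.maxDomain) : Fin (n + 1) → Fin 2 → ℝ → ℂ := x.2.choose

/-- The derivative `(𝓗 x)'` on `[0,1]`. -/
noncomputable def effort₁ (x : c.maxDomain) : Fin (n + 1) → Fin 2 → ℝ → ℂ :=
  x.2.choose_spec.choose

/-- The second derivative `(𝓗 x)''`. -/
noncomputable def effort₂ (x : c.maxDomain) : Fin (n + 1) → Fin 2 → ℝ → ℂ :=
  x.2.choose_spec.choose_spec.choose

theorem isEffort (x : c.maxDomain) :
    c.IsEffort (x : BeamSpace n) (c.effort x) (c.effort₁ x) (c.effort₂ x) :=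
  x.2.choose_spec.choose_spec.choose_spec

/-- The function `P₂ (𝓗 x)''`, where the `j`-th block of `P₂` is
`(l^j - l^{j-1})⁻² [[0, -1], [1, 0]]`. -/
noncomputable def opFun (x : c.maxDomain) (ζ : ℝ) : EuclideanSpace ℂ (Fin (n + 1) × Fin 2) :=
  WithLp.toLp 2 fun p =>
    ((c.len p.1 : ℂ) ^ 2)⁻¹ * ![-c.effort₂ x p.1 1 ζ, c.effort₂ x p.1 0 ζ] p.2

theorem memLp_opFun (x : c.maxDomain) :
    MemLp (c.opFun x) 2 (volume.restrict (Ioo (0 : ℝ) 1)) := by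
  refine MemLp.of_eval_piLp ?_
  rintro ⟨j, i⟩
  have h0 := ((c.isEffort x).second j 0).memLp
  have h1 := ((c.isEffort x).second j 1).memLp
  fin_cases i
  · simpa [opFun] using h1.neg.const_mul (((c.len j : ℂ) ^ 2)⁻¹)
  · simpa [opFun] using h0.const_mul (((c.len j : ℂ) ^ 2)⁻¹)

/-- The maximal operator `𝔄 x = P₂ (𝓗 x)''` on `D(𝔄)`. -/
noncomputable def maxOp : BeamSpace n →ₗ.[ℂ] BeamSpace n where
  domain := c.maxDomain
  toFun :=
    { toFun := fun x => (c.memLp_opFun x).toLp (c.opFun x)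
      map_add' := by
        intro x y
        rw [← MemLp.toLp_add, MemLp.toLp_eq_toLp_iff]
        have h : ∀ j i, ∀ᵐ t ∂(volume.restrict (Ioo (0 : ℝ) 1)),
            c.effort₂ (x + y) j i t = c.effort₂ x j i t + c.effort₂ y j i t := fun j i =>
          ((c.isEffort (x + y)).unique ((c.isEffort x).add (c.isEffort y)) j i).2.2
        simp only [← ae_all_iff] at h
        filter_upwards [h] with t ht
        ext ⟨j, i⟩
        fin_cases i <;> simp [opFun, ht] <;> ring
      map_smul' := by
        intro a x
        rw [RingHom.id_apply, ← MemLp.toLp_const_smul, MemLp.toLp_eq_toLp_iff]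
        have h : ∀ j i, ∀ᵐ t ∂(volume.restrict (Ioo (0 : ℝ) 1)),
            c.effort₂ (a • x) j i t = a * c.effort₂ x j i t := fun j i =>
          ((c.isEffort (a • x)).unique ((c.isEffort x).smul a) j i).2.2
        simp only [← ae_all_iff] at h
        filter_upwards [h] with t ht
        ext ⟨j, i⟩
        fin_cases i <;> simp [opFun, ht] <;> ring }

/-- The trace `(𝓗^j_i x^j_i)(s)` at an end `s ∈ [0,1]` of beam `j`, that is the one-sided limit of
`ω_t` (for `i = 0`) or of `EI ω_{ζζ}` (for `i = 1`). -/
noncomputable def val (j : Fin (n + 1)) (i : Fin 2) (s : Icc (0 : ℝ) 1) : c.maxDomain →ₗ[ℂ] ℂ where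
  toFun x := c.effort x j i s
  map_add' x y :=
    ((c.isEffort (x + y)).unique ((c.isEffort x).add (c.isEffort y)) j i).1 s s.2
  map_smul' a x := ((c.isEffort (a • x)).unique ((c.isEffort x).smul a) j i).1 s s.2

/-- The trace of the spatial derivative at an end `s ∈ [0,1]` of beam `j`, that is the one-sided limit
of `ω_{tζ}` (for `i = 0`) or of `(EI ω_{ζζ})_ζ` (for `i = 1`).  The derivative is taken with respect to
the physical position, whence the division of the derivative in the reference variable by the length
of the beam. -/
noncomputable def der (j : Fin (n + 1)) (i : Fin 2) (s : Icc (0 : ℝ) 1) : c.maxDomain →ₗ[ℂ] ℂ where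
  toFun x := (c.len j : ℂ)⁻¹ * c.effort₁ x j i s
  map_add' x y := by
    rw [((c.isEffort (x + y)).unique ((c.isEffort x).add (c.isEffort y)) j i).2.1 s s.2, mul_add]
  map_smul' a x := by
    rw [((c.isEffort (a • x)).unique ((c.isEffort x).smul a) j i).2.1 s s.2, RingHom.id_apply,
      smul_eq_mul]
    ring

/-- Jump (left limit minus right limit) of `ω_t` (`i = 0`) or `EI ω_{ζζ}` (`i = 1`) at junction `k`. -/
noncomputable def jumpVal (k : Fin n) (i : Fin 2) : c.maxDomain →ₗ[ℂ] ℂ :=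
  c.val k.castSucc i 1 - c.val k.succ i 0

/-- Jump (left limit minus right limit) of `ω_{tζ}` (`i = 0`) or `(EI ω_{ζζ})_ζ` (`i = 1`) at junction
`k`. -/
noncomputable def jumpDer (k : Fin n) (i : Fin 2) : c.maxDomain →ₗ[ℂ] ℂ :=
  c.der k.castSucc i 1 - c.der k.succ i 0

/-- The continuity map `𝔅₀^j` at junction `k`: the jumps of the two continuous quantities. -/
noncomputable def junctionB₀ (k : Fin n) : c.maxDomain →ₗ[ℂ] (Fin 2 → ℂ) :=
  match c.junction k with
  | .velocityAngular => LinearMap.pi ![c.jumpVal k 0, c.jumpDer k 0]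
  | .velocityMoment => LinearMap.pi ![c.jumpVal k 0, c.jumpVal k 1]
  | .shearAngular => LinearMap.pi ![-c.jumpDer k 1, c.jumpDer k 0]
  | .shearMoment => LinearMap.pi ![-c.jumpDer k 1, c.jumpVal k 1]

/-- The control map `𝔅^j` at junction `k`: the jumps of the two remaining quantities. -/
noncomputable def junctionB (k : Fin n) : c.maxDomain →ₗ[ℂ] (Fin 2 → ℂ) :=
  match c.junction k with
  | .velocityAngular => LinearMap.pi ![-c.jumpDer k 1, c.jumpVal k 1]
  | .velocityMoment => LinearMap.pi ![-c.jumpDer k 1, c.jumpDer k 0]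
  | .shearAngular => LinearMap.pi ![c.jumpVal k 0, c.jumpVal k 1]
  | .shearMoment => LinearMap.pi ![c.jumpVal k 0, c.jumpDer k 0]

/-- The control map `𝔅⁰` at the left end: `WB₀` applied to
`(ω_t, EI ω_{ζζ}, -(EI ω_{ζζ})_ζ, ω_{tζ})(0)`. -/
noncomputable def leftB : c.maxDomain →ₗ[ℂ] (Fin 2 → ℂ) :=
  c.WB₀.mulVecLin ∘ₗ LinearMap.pi ![c.val 0 0 0, c.val 0 1 0, -c.der 0 1 0, c.der 0 0 0]

/-- The control map `𝔅^m` at the right end: `WBm` applied to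
`(ω_t, EI ω_{ζζ}, (EI ω_{ζζ})_ζ, -ω_{tζ})(L)`. -/
noncomputable def rightB : c.maxDomain →ₗ[ℂ] (Fin 2 → ℂ) :=
  c.WBm.mulVecLin ∘ₗ LinearMap.pi ![c.val (Fin.last n) 0 1, c.val (Fin.last n) 1 1,
    c.der (Fin.last n) 1 1, -c.der (Fin.last n) 0 1]

/-- `D(𝔄₀) = ⋂_j ker 𝔅₀^j`, as a subspace of `L²(0,1; ℂ^{2m})`. -/
noncomputable def domain₀ : Submodule ℂ (BeamSpace n) :=
  (⨅ k, LinearMap.ker (c.junctionB₀ k)).map c.maxDomain.subtype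

theorem domain₀_le : c.domain₀ ≤ c.maxDomain := by
  rintro _ ⟨x, -, rfl⟩
  exact x.2

/-- The operator `𝔄₀`, the restriction of `𝔄` to `D(𝔄₀)`. -/
noncomputable def op₀ : BeamSpace n →ₗ.[ℂ] BeamSpace n where
  domain := c.domain₀
  toFun := c.maxOp.toFun ∘ₗ Submodule.inclusion c.domain₀_le

/-- The control map `𝔅 = (𝔅^0, 𝔅^1, …, 𝔅^m)` on `D(𝔄₀)`. -/
noncomputable def B :
    c.op₀.domain →ₗ[ℂ] (Fin 2 → ℂ) × (Fin n → Fin 2 → ℂ) × (Fin 2 → ℂ) :=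
  (c.leftB.prod ((LinearMap.pi c.junctionB).prod c.rightB)) ∘ₗ
    Submodule.inclusion c.domain₀_le

/-- The map `ℜ : D(𝔄₀) → ℂ⁵`.  Its first two components are `(𝓗^1 x^1)(0)`; the three flags choose the
remaining ones: `(𝓗^1_1 x^1_1)'(0)` or `(𝓗^1_2 x^1_2)'(0)`, then `(𝓗^m_1 x^m_1)(1)` or
`(𝓗^m_2 x^m_2)'(1)`, then `(𝓗^m_1 x^m_1)'(1)` or `(𝓗^m_2 x^m_2)(1)`. -/
noncomputable def R (a b d : Bool) : c.op₀.domain →ₗ[ℂ] (Fin 5 → ℂ) :=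
  (LinearMap.pi ![c.val 0 0 0, c.val 0 1 0,
    if a then c.der 0 0 0 else c.der 0 1 0,
    if b then c.val (Fin.last n) 0 1 else c.der (Fin.last n) 1 1,
    if d then c.der (Fin.last n) 0 1 else c.val (Fin.last n) 1 1]) ∘ₗ
    Submodule.inclusion c.domain₀_le

end BeamChain

/-! A rotation of the moment makes the problem real. Write β = σ s² with σ = ±1 and N = iσM. On a
beam of length h the equation (𝔄 - iβ)x = F becomes v'' = s² a N + g, N'' = s² r v + f with positive
coefficients a = h²/EI and r = h²ρ. Real and imaginary parts decouple, so real solutions suffice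
(`BeamChain.isMode_toState`).

Two quadratic quantities are conserved up to a', r', g and f: E = aN² + rv² - 2s⁻²v'N' and D = rv'²
+ aN'² - 2s²arvN. Interpolation bounds v', N' by O(s) in L², and then E = O(1) and D = O(s²) hold
pointwise. Moreover (vN)'' = 2s²(aN² + rv²) - s²E + gN + fv. Hence, for a weight q, the flux T = qE
+ s⁻²q'(vN)' has derivative (2q'a + qa')N² + (2q'r + qr')v² up to terms with vanishing integral. The
weight q(z) = exp(-κL) - exp(-κz) with κ large makes this coercive (`BeamState.IsMode.flux_bound`).

Summing over the beams leaves boundary terms. At L the weight vanishes and only s⁻²(v'N + vN')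
remains; one vanishing factor in each product is enough. At 0 both v and N vanish in the limit, and
v'N' needs one further factor. At a junction q ≤ 0, and the jump condition makes ρ and 1/EI
nonincreasing, so the change of coefficients has the good sign. What remains there consists of jumps
multiplied by traces.

These products are the difficulty, since interpolation only gives v, N = O(s^(1/2)) at a point. The
bounds on E and D show that traces can be large only where vN is large and positive. But (vN)'' ≥
(2ms)²vN up to controlled errors, where m ∈ (0,1] is a lower bound for a and r. So (vN)' ≥ 2ms vN -
Cs at the right end of a beam and (vN)' ≤ -2ms vN + Cs at the left end of the next one. Bounded
jumps make the two sides nearly agree, which bounds vN and hence all junction traces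
(`BeamState.exists_junction_bound`). -/

/-! ### Absolutely continuous functions on the unit interval and interpolation. -/

/-- Lebesgue measure on the reference interval `(0,1)`. -/
noncomputable abbrev unitVol : Measure ℝ := volume.restrict (Ioo (0 : ℝ) 1)

/-- `f` is absolutely continuous on `[0,1]` with almost everywhere derivative `f'`. -/
structure ACDeriv (f f' : ℝ → ℝ) : Prop where
  ac : AbsolutelyContinuousOnInterval f 0 1
  deriv : ∀ᵐ t ∂unitVol, HasDerivAt f (f' t) t

namespace ACDeriv

variable {f f' g g' : ℝ → ℝ}

theorem add (hf : ACDeriv f f') (hg : ACDeriv g g') :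
    ACDeriv (fun t => f t + g t) (fun t => f' t + g' t) where
  ac := hf.ac.add hg.ac
  deriv := by
    filter_upwards [hf.deriv, hg.deriv] with t h1 h2 using h1.add h2

theorem mul (hf : ACDeriv f f') (hg : ACDeriv g g') :
    ACDeriv (fun t => f t * g t) (fun t => f' t * g t + f t * g' t) where
  ac := hf.ac.mul hg.ac
  deriv := by
    filter_upwards [hf.deriv, hg.deriv] with t h1 h2 using h1.mul h2

theorem const_mul (c : ℝ) (hf : ACDeriv f f') :
    ACDeriv (fun t => c * f t) (fun t => c * f' t) where
  ac := hf.ac.const_mul c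
  deriv := by
    filter_upwards [hf.deriv] with t h1 using h1.const_mul c

theorem congr (hf : ACDeriv f f') (h : ∀ᵐ t ∂unitVol, f' t = g' t) : ACDeriv f g' where
  ac := hf.ac
  deriv := by
    filter_upwards [hf.deriv, h] with t h1 h2
    rwa [← h2]

theorem of_contDiff (hf : ContDiff ℝ 1 f) (h : ∀ t, HasDerivAt f (f' t) t) : ACDeriv f f' where
  ac := hf.contDiffOn.absolutelyContinuousOnInterval
  deriv := ae_of_all _ h

theorem const (c : ℝ) : ACDeriv (fun _ => c) (fun _ => 0) :=
  of_contDiff contDiff_const fun t => hasDerivAt_const t c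

theorem continuousOn (hf : ACDeriv f f') : ContinuousOn f (Icc 0 1) := by
  have := hf.ac.continuousOn
  rwa [uIcc_of_le zero_le_one] at this

theorem integrable (hf : ACDeriv f f') : Integrable f' unitVol := by
  have h := hf.ac.intervalIntegrable_deriv
  rw [intervalIntegrable_iff_integrableOn_Ioo_of_le zero_le_one] at h
  refine Integrable.congr h ?_
  filter_upwards [hf.deriv] with t ht using ht.deriv

theorem integral_eq (hf : ACDeriv f f') {s t : ℝ} (hs : 0 ≤ s) (hst : s ≤ t) (ht : t ≤ 1) :
    ∫ x in Ioo s t, f' x = f t - f s := by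
  have hsub : uIcc s t ⊆ uIcc 0 1 := by
    rw [uIcc_of_le hst, uIcc_of_le zero_le_one]
    exact Icc_subset_Icc hs ht
  rw [← (hf.ac.mono hsub).integral_deriv_eq_sub, intervalIntegral.integral_of_le hst,
    integral_Ioc_eq_integral_Ioo]
  refine integral_congr_ae ?_
  have h : ∀ᵐ x ∂(volume.restrict (Ioo s t)), HasDerivAt f (f' x) x :=
    ae_mono (Measure.restrict_mono (Ioo_subset_Ioo hs ht) le_rfl) hf.deriv
  filter_upwards [h] with x hx using hx.deriv.symm

/-- A lower bound for the derivative bounds the decrease. -/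
theorem sub_le (hf : ACDeriv f f') {h : ℝ → ℝ} (hi : Integrable h unitVol)
    (h0 : ∀ᵐ t ∂unitVol, 0 ≤ h t) (hle : ∀ᵐ t ∂unitVol, -h t ≤ f' t)
    {s t : ℝ} (hs : 0 ≤ s) (hst : s ≤ t) (ht : t ≤ 1) :
    f s - ∫ x, h x ∂unitVol ≤ f t := by
  have hm : volume.restrict (Ioo s t) ≤ unitVol :=
    Measure.restrict_mono (Ioo_subset_Ioo hs ht) le_rfl
  have h1 : ∫ x in Ioo s t, -h x ≤ ∫ x in Ioo s t, f' x :=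
    integral_mono_ae (hi.mono_measure hm).neg (hf.integrable.mono_measure hm) (ae_mono hm hle)
  have h2 : ∫ x in Ioo s t, h x ≤ ∫ x, h x ∂unitVol :=
    integral_mono_measure hm h0 hi
  rw [hf.integral_eq hs hst ht, integral_neg] at h1
  linarith

theorem integrable_self (hf : ACDeriv f f') : Integrable f unitVol :=
  (hf.continuousOn.integrableOn_Icc).mono_set Ioo_subset_Icc_self

theorem neg (hf : ACDeriv f f') : ACDeriv (fun t => -f t) (fun t => -f' t) := by
  simpa using hf.const_mul (-1)

/-- Every earlier value exceeds `f 1` by at most the integral of `h`. Averaging over the interval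
replaces the unknown earlier value by the L¹ norm of `f`. -/
theorem le_right (hf : ACDeriv f f') {h : ℝ → ℝ} (hi : Integrable h unitVol)
    (h0 : ∀ᵐ t ∂unitVol, 0 ≤ h t) (hle : ∀ᵐ t ∂unitVol, -h t ≤ f' t) :
    -(∫ x, |f x| ∂unitVol) - ∫ x, h x ∂unitVol ≤ f 1 := by
  have h1 : ∫ x, -|f x| ∂unitVol ≤ ∫ _, (f 1 + ∫ x, h x ∂unitVol) ∂unitVol := by
    refine integral_mono_ae hf.integrable_self.abs.neg (integrable_const _) ?_
    filter_upwards [ae_restrict_mem measurableSet_Ioo] with x hx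
    have := hf.sub_le hi h0 hle hx.1.le hx.2.le le_rfl
    have := neg_abs_le (f x)
    linarith
  simp [integral_neg] at h1
  linarith

theorem left_le (hf : ACDeriv f f') {h : ℝ → ℝ} (hi : Integrable h unitVol)
    (h0 : ∀ᵐ t ∂unitVol, 0 ≤ h t) (hle : ∀ᵐ t ∂unitVol, -h t ≤ f' t) :
    f 0 ≤ ∫ x, |f x| ∂unitVol + ∫ x, h x ∂unitVol := by
  have h1 : ∫ _, (f 0 - ∫ x, h x ∂unitVol) ∂unitVol ≤ ∫ x, |f x| ∂unitVol := by
    refine integral_mono_ae (integrable_const _) hf.integrable_self.abs ?_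
    filter_upwards [ae_restrict_mem measurableSet_Ioo] with x hx
    have := hf.sub_le hi h0 hle le_rfl hx.1.le hx.2.le
    have := le_abs_self (f x)
    linarith
  simp at h1
  linarith

theorem abs_le (hf : ACDeriv f f') {h : ℝ → ℝ} (hi : Integrable h unitVol)
    (hle : ∀ᵐ t ∂unitVol, |f' t| ≤ h t) {t : ℝ} (ht : t ∈ Icc (0 : ℝ) 1) :
    |f t| ≤ ∫ x, |f x| ∂unitVol + ∫ x, h x ∂unitVol := by
  have h0 : ∀ᵐ t ∂unitVol, 0 ≤ h t := hle.mono fun x hx => (abs_nonneg _).trans hx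
  have hl : ∀ᵐ t ∂unitVol, -h t ≤ f' t := hle.mono fun x hx => (_root_.abs_le.1 hx).1
  have hu : ∀ᵐ t ∂unitVol, -h t ≤ -f' t := hle.mono fun x hx => by
    linarith [(_root_.abs_le.1 hx).2]
  have h1 : ∫ _, (|f t| - ∫ x, h x ∂unitVol) ∂unitVol ≤ ∫ x, |f x| ∂unitVol := by
    refine integral_mono_ae (integrable_const _) hf.integrable_self.abs ?_
    filter_upwards [ae_restrict_mem measurableSet_Ioo] with x hx
    have e1 := le_abs_self (f x)
    have e2 := neg_abs_le (f x)
    simp only [tsub_le_iff_right]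
    rcases le_total x t with hxt | hxt
    · have := hf.sub_le hi h0 hl hx.1.le hxt ht.2
      have := hf.neg.sub_le hi h0 hu hx.1.le hxt ht.2
      rw [_root_.abs_le]; constructor <;> linarith
    · have := hf.sub_le hi h0 hl ht.1 hxt hx.2.le
      have := hf.neg.sub_le hi h0 hu ht.1 hxt hx.2.le
      rw [_root_.abs_le]; constructor <;> linarith
  simp at h1
  linarith

theorem memLp (hf : ACDeriv f f') : MemLp f 2 unitVol := by
  obtain ⟨C, hC⟩ := isCompact_Icc.exists_bound_of_continuousOn hf.continuousOn
  refine MemLp.of_bound hf.integrable_self.aestronglyMeasurable C ?_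
  filter_upwards [ae_restrict_mem measurableSet_Ioo] with x hx
  exact hC x (Ioo_subset_Icc_self hx)

/-- Pointwise bound by the `L²` norms of the function and of its derivative. -/
theorem sq_le (hf : ACDeriv f f') (hf' : MemLp f' 2 unitVol) {l : ℝ} (hl : 0 < l) {t : ℝ}
    (ht : t ∈ Icc (0 : ℝ) 1) :
    f t ^ 2 ≤ ∫ x, f x ^ 2 ∂unitVol + (l * ∫ x, f x ^ 2 ∂unitVol + (∫ x, f' x ^ 2 ∂unitVol) / l) := by
  -- The mean value bound is applied to f², with |2ff'| ≤ l f² + f'²/l; the free parameter `l`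
  -- balances the two integrals.
  have h := (hf.mul hf).abs_le (h := fun x => l * f x ^ 2 + f' x ^ 2 / l)
    ((hf.memLp.integrable_sq.const_mul l).add (hf'.integrable_sq.div_const l))
    (ae_of_all _ fun x => by
      have h1 : l * f x ^ 2 + f' x ^ 2 / l = ((l * f x) ^ 2 + f' x ^ 2) / l := by field_simp
      rw [h1, le_div_iff₀ hl, ← abs_of_pos hl, ← abs_mul, _root_.abs_le, abs_of_pos hl]
      constructor <;> nlinarith [sq_nonneg (l * f x + f' x), sq_nonneg (l * f x - f' x)]) ht
  rw [integral_add (hf.memLp.integrable_sq.const_mul l) (hf'.integrable_sq.div_const l),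
    integral_const_mul, integral_div] at h
  simpa [← pow_two] using h

/-- Interpolation of a derivative between a function and its second derivative. -/
theorem interpolation {f'' : ℝ → ℝ} (hf : ACDeriv f f') (hf' : ACDeriv f' f'')
    (hf'' : MemLp f'' 2 unitVol) {B s : ℝ} (hs : 1 ≤ s) (h0 : ∫ x, f x ^ 2 ∂unitVol ≤ B)
    (h2 : ∫ x, f'' x ^ 2 ∂unitVol ≤ B * s ^ 4) :
    ∫ x, f' x ^ 2 ∂unitVol ≤ 360 * B * s ^ 2 ∧
    ∀ t ∈ Icc (0 : ℝ) 1, f t ^ 2 ≤ 362 * B * s ∧ f' t ^ 2 ≤ 721 * B * s ^ 3 := by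
  have s0 : 0 < s := by linarith
  set X := ∫ x, f' x ^ 2 ∂unitVol with hX
  have X0 : 0 ≤ X := integral_nonneg fun x => sq_nonneg _
  have B0 : 0 ≤ B := (integral_nonneg fun x => sq_nonneg _).trans h0
  have e1 : ∀ t ∈ Icc (0 : ℝ) 1, ∀ l : ℝ, 1 ≤ l → f t ^ 2 ≤ (1 + l) * s * B + X / (l * s) := by
    intro t ht l hl
    have h := hf.sq_le hf'.memLp (l := l * s) (by positivity) ht
    have : (l * s) * ∫ x, f x ^ 2 ∂unitVol ≤ l * s * B := by gcongr
    have : B ≤ s * B := by nlinarith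
    rw [← hX] at h
    linarith
  have e2 : ∀ t ∈ Icc (0 : ℝ) 1, f' t ^ 2 ≤ 2 * s * X + B * s ^ 3 := by
    intro t ht
    have h := hf'.sq_le hf'' s0 ht
    rw [← hX] at h
    have : (∫ x, f'' x ^ 2 ∂unitVol) / s ≤ B * s ^ 3 := by
      rw [div_le_iff₀ s0]; linarith
    have : X ≤ s * X := by nlinarith
    linarith
  -- The choice l = 32 in `e1` keeps the share of X at 2/32 + 1/4 = 5/16 per endpoint. The two
  -- boundary terms of the integration by parts in `e4` then cost 5/8 X, which can be absorbed: 3/8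
  -- X ≤ 135 B s².
  have e3 : ∀ t ∈ Icc (0 : ℝ) 1, |f t * f' t| ≤ 67 * B * s ^ 2 + 5 / 16 * X := by
    intro t ht
    have h1 := e1 t ht 32 (by norm_num)
    have h2 := e2 t ht
    have h3 : s * |f t * f' t| ≤ 2 * s ^ 2 * f t ^ 2 + f' t ^ 2 / 8 := by
      rw [← abs_of_pos s0, ← abs_mul, _root_.abs_le, abs_of_pos s0]
      constructor <;> nlinarith [sq_nonneg (4 * s * f t + f' t), sq_nonneg (4 * s * f t - f' t)]
    have h4 : s ^ 2 * f t ^ 2 ≤ s ^ 2 * ((1 + 32) * s * B + X / (32 * s)) := by gcongr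
    have h5 : s ^ 2 * ((1 + 32) * s * B + X / (32 * s)) = 33 * s ^ 3 * B + s * X / 32 := by
      field_simp; ring
    have h6 : 0 ≤ B * s ^ 3 := by positivity
    have : s * |f t * f' t| ≤ s * (67 * B * s ^ 2 + 5 / 16 * X) := by nlinarith
    exact le_of_mul_le_mul_left this s0
  have e4 : X ≤ 360 * B * s ^ 2 := by
    have hp := (hf.mul hf').integral_eq le_rfl zero_le_one le_rfl
    have i1 : Integrable (fun x => f' x * f' x) unitVol := hf'.memLp.integrable_mul hf'.memLp
    have i2 : Integrable (fun x => f x * f'' x) unitVol := hf.memLp.integrable_mul hf''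
    rw [integral_add i1 i2] at hp
    have h3 : -(∫ x, f x * f'' x ∂unitVol) ≤
        ∫ x, (s ^ 2 * f x ^ 2 / 2 + f'' x ^ 2 / (2 * s ^ 2)) ∂unitVol := by
      rw [← integral_neg]
      refine integral_mono i2.neg (((hf.memLp.integrable_sq.const_mul _).div_const _).add
        (hf''.integrable_sq.div_const _)) fun x => ?_
      have : s ^ 2 * f x ^ 2 / 2 + f'' x ^ 2 / (2 * s ^ 2) + f x * f'' x
        = (s ^ 2 * f x + f'' x) ^ 2 / (2 * s ^ 2) := by field_simp; ring
      have : 0 ≤ (s ^ 2 * f x + f'' x) ^ 2 / (2 * s ^ 2) := by positivity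
      linarith
    rw [integral_add ((hf.memLp.integrable_sq.const_mul _).div_const _)
        (hf''.integrable_sq.div_const _), integral_div, integral_const_mul, integral_div] at h3
    have h4 : (∫ x, f'' x ^ 2 ∂unitVol) / (2 * s ^ 2) ≤ B * s ^ 2 / 2 := by
      rw [div_le_iff₀ (by positivity)]; linarith
    have h5 : s ^ 2 * ∫ x, f x ^ 2 ∂unitVol ≤ s ^ 2 * B := by gcongr
    have h6 : X = ∫ x, f' x * f' x ∂unitVol := by simp only [hX, pow_two]
    have := (_root_.abs_le.1 (e3 0 (by simp))).1
    have := (_root_.abs_le.1 (e3 1 (by simp))).2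
    rw [← h6] at hp
    linarith
  refine ⟨e4, fun t ht => ⟨?_, ?_⟩⟩
  · have h := e1 t ht 1 le_rfl
    have : X / (1 * s) ≤ 360 * B * s := by
      rw [div_le_iff₀ (by positivity)]; linarith
    linarith
  · have h := e2 t ht
    have : 2 * s * X ≤ 2 * s * (360 * B * s ^ 2) := by gcongr
    linarith

end ACDeriv

/-! ### The real system on one beam and its a priori bounds. -/

/-- A coefficient on `[0,1]` with positive lower bound `m` and upper bound `K`, whose derivative is
bounded by `K`. -/
structure IsCoef (m K : ℝ) (a a' : ℝ → ℝ) : Prop where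
  acDeriv : ACDeriv a a'
  lower : ∀ t ∈ Icc (0 : ℝ) 1, m ≤ a t
  upper : ∀ t ∈ Icc (0 : ℝ) 1, a t ≤ K
  deriv_le : ∀ᵐ t ∂unitVol, |a' t| ≤ K

/-- Velocity `v` and (rotated) moment `N` with their derivatives, and the right hand sides `g`, `f`. -/
structure BeamState where
  v : ℝ → ℝ
  v1 : ℝ → ℝ
  N : ℝ → ℝ
  N1 : ℝ → ℝ
  g : ℝ → ℝ
  f : ℝ → ℝ

namespace BeamState

/-- The equations `v'' = s² a N + g`, `N'' = s² r v + f`. -/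
structure IsMode (u : BeamState) (a r : ℝ → ℝ) (s : ℝ) : Prop where
  v : ACDeriv u.v u.v1
  v1 : ACDeriv u.v1 (fun t => s ^ 2 * (a t * u.N t) + u.g t)
  N : ACDeriv u.N u.N1
  N1 : ACDeriv u.N1 (fun t => s ^ 2 * (r t * u.v t) + u.f t)
  g : MemLp u.g 2 unitVol
  f : MemLp u.f 2 unitVol

/-- The squares of the `L²` norms of `v`, `N`, `g`, `f` are at most `B`. -/
structure IsBounded (u : BeamState) (B : ℝ) : Prop where
  v : ∫ x, u.v x ^ 2 ∂unitVol ≤ B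
  N : ∫ x, u.N x ^ 2 ∂unitVol ≤ B
  g : ∫ x, u.g x ^ 2 ∂unitVol ≤ B
  f : ∫ x, u.f x ^ 2 ∂unitVol ≤ B

/-- A dominating quadratic function. -/
def dom (u : BeamState) (α β γ : ℝ) (t : ℝ) : ℝ :=
  α * (u.v t ^ 2 + u.N t ^ 2) + β * (u.v1 t ^ 2 + u.N1 t ^ 2) + γ * (u.g t ^ 2 + u.f t ^ 2)

/-- The bound for the derivatives in terms of the bound for the functions and right hand sides. -/
def derivBound (K B : ℝ) : ℝ := 1442 * (K ^ 2 + 1) * B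

variable {u : BeamState} {a a' r r' : ℝ → ℝ} {s m K B : ℝ}

theorem dom_nonneg {α β γ : ℝ} (hα : 0 ≤ α) (hβ : 0 ≤ β) (hγ : 0 ≤ γ) (t : ℝ) :
    0 ≤ u.dom α β γ t := by
  unfold dom; positivity

theorem IsBounded.nonneg (hB : u.IsBounded B) : 0 ≤ B :=
  (integral_nonneg fun _ => sq_nonneg _).trans hB.v

/-- Brings the second derivatives into the form B' s⁴ with B' = 2(K² + 1)B that
`ACDeriv.interpolation` expects; the forcing is absorbed through 1 ≤ s⁴. -/
theorem integral_sq_rhs_le {N g : ℝ → ℝ} (hs : 1 ≤ s) (hN : MemLp N 2 unitVol)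
    (hg : MemLp g 2 unitVol) (iN : ∫ x, N x ^ 2 ∂unitVol ≤ B) (ig : ∫ x, g x ^ 2 ∂unitVol ≤ B)
    (hm : 0 < m) (ha : IsCoef m K a a') :
    MemLp (fun t => s ^ 2 * (a t * N t) + g t) 2 unitVol ∧
    ∫ x, (s ^ 2 * (a x * N x) + g x) ^ 2 ∂unitVol ≤ (2 * (K ^ 2 + 1) * B) * s ^ 4 := by
  have haN : MemLp (fun t => a t * N t) 2 unitVol := by
    refine MemLp.of_le (hN.const_mul K)
      (ha.acDeriv.integrable_self.aestronglyMeasurable.mul hN.aestronglyMeasurable) ?_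
    filter_upwards [ae_restrict_mem measurableSet_Ioo] with x hx
    have hx' := Ioo_subset_Icc_self hx
    have h1 := ha.lower x hx'
    have h2 := ha.upper x hx'
    simp only [norm_mul, Real.norm_eq_abs]
    rw [abs_of_pos (by linarith : 0 < a x), abs_of_pos (by linarith : 0 < K)]
    gcongr
  have hL := (haN.const_mul (s ^ 2)).add hg
  refine ⟨hL, ?_⟩
  have h1 : ∫ x, (s ^ 2 * (a x * N x) + g x) ^ 2 ∂unitVol ≤
      ∫ x, (2 * s ^ 4 * K ^ 2 * N x ^ 2 + 2 * g x ^ 2) ∂unitVol := by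
    refine integral_mono_ae hL.integrable_sq
      ((hN.integrable_sq.const_mul _).add (hg.integrable_sq.const_mul _)) ?_
    filter_upwards [ae_restrict_mem measurableSet_Ioo] with x hx
    have hx' := Ioo_subset_Icc_self hx
    have h1 := ha.lower x hx'
    have h2 := ha.upper x hx'
    have h3 : a x ^ 2 ≤ K ^ 2 := by gcongr; linarith
    have h4 : s ^ 4 * N x ^ 2 * a x ^ 2 ≤ s ^ 4 * N x ^ 2 * K ^ 2 := by gcongr
    nlinarith [sq_nonneg (s ^ 2 * (a x * N x) - g x)]
  rw [integral_add (hN.integrable_sq.const_mul _) (hg.integrable_sq.const_mul _),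
    integral_const_mul, integral_const_mul] at h1
  have h2 : 2 * s ^ 4 * K ^ 2 * ∫ x, N x ^ 2 ∂unitVol ≤ 2 * s ^ 4 * K ^ 2 * B := by gcongr
  have h3 : 1 ≤ s ^ 4 := one_le_pow₀ hs
  have h4 : 0 ≤ B := (integral_nonneg fun _ => sq_nonneg _).trans iN
  nlinarith

namespace IsMode

/-- Second derivatives have size s² in L², so by interpolation a derivative costs one factor s, and
evaluation at a point a further s^(1/2). -/
theorem derivative_bounds (hu : u.IsMode a r s) (hB : u.IsBounded B) (hs : 1 ≤ s) (hm : 0 < m)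
    (ha : IsCoef m K a a') (hr : IsCoef m K r r') :
    (∫ x, u.v1 x ^ 2 ∂unitVol ≤ derivBound K B * s ^ 2 ∧
      ∫ x, u.N1 x ^ 2 ∂unitVol ≤ derivBound K B * s ^ 2) ∧
    ∀ t ∈ Icc (0 : ℝ) 1, (u.v t ^ 2 ≤ derivBound K B * s ∧ u.N t ^ 2 ≤ derivBound K B * s) ∧
      u.v1 t ^ 2 ≤ derivBound K B * s ^ 3 ∧ u.N1 t ^ 2 ≤ derivBound K B * s ^ 3 := by
  obtain ⟨L1, I1⟩ := integral_sq_rhs_le hs hu.N.memLp hu.g hB.N hB.g hm ha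
  obtain ⟨L2, I2⟩ := integral_sq_rhs_le hs hu.v.memLp hu.f hB.v hB.f hm hr
  have hB0 := hB.nonneg
  have hB1 : B ≤ 2 * (K ^ 2 + 1) * B := by nlinarith [sq_nonneg K, mul_nonneg (sq_nonneg K) hB0]
  obtain ⟨p1, p2⟩ := hu.v.interpolation hu.v1 L1 hs (hB.v.trans hB1) I1
  obtain ⟨q1, q2⟩ := hu.N.interpolation hu.N1 L2 hs (hB.N.trans hB1) I2
  have hD : derivBound K B = 721 * (2 * (K ^ 2 + 1) * B) := by unfold derivBound; ring
  have hB2 : 0 ≤ 2 * (K ^ 2 + 1) * B := hB0.trans hB1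
  rw [hD]
  have s0 : 0 ≤ s := by linarith
  have k2 : 0 ≤ 2 * (K ^ 2 + 1) * B * s ^ 2 := by positivity
  have k1 : 0 ≤ 2 * (K ^ 2 + 1) * B * s := by positivity
  refine ⟨⟨by linarith, by linarith⟩, fun t ht => ?_⟩
  obtain ⟨h1, h2⟩ := p2 t ht
  obtain ⟨h3, h4⟩ := q2 t ht
  exact ⟨⟨by linarith, by linarith⟩, h2, h4⟩

theorem integrable_dom (hu : u.IsMode a r s) (α β γ : ℝ) : Integrable (u.dom α β γ) unitVol :=
  (((hu.v.memLp.integrable_sq.add hu.N.memLp.integrable_sq).const_mul α).add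
    ((hu.v1.memLp.integrable_sq.add hu.N1.memLp.integrable_sq).const_mul β)).add
    ((hu.g.integrable_sq.add hu.f.integrable_sq).const_mul γ)

theorem integral_dom (hu : u.IsMode a r s) (α β γ : ℝ) :
    ∫ x, u.dom α β γ x ∂unitVol =
      α * (∫ x, u.v x ^ 2 ∂unitVol + ∫ x, u.N x ^ 2 ∂unitVol) +
      β * (∫ x, u.v1 x ^ 2 ∂unitVol + ∫ x, u.N1 x ^ 2 ∂unitVol) +
      γ * (∫ x, u.g x ^ 2 ∂unitVol + ∫ x, u.f x ^ 2 ∂unitVol) := by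
  have h1 : Integrable (fun x => α * (u.v x ^ 2 + u.N x ^ 2)) unitVol :=
    (hu.v.memLp.integrable_sq.add hu.N.memLp.integrable_sq).const_mul α
  have h2 : Integrable (fun x => β * (u.v1 x ^ 2 + u.N1 x ^ 2)) unitVol :=
    (hu.v1.memLp.integrable_sq.add hu.N1.memLp.integrable_sq).const_mul β
  have h3 : Integrable (fun x => γ * (u.g x ^ 2 + u.f x ^ 2)) unitVol :=
    (hu.g.integrable_sq.add hu.f.integrable_sq).const_mul γ
  have h12 : Integrable (fun x => α * (u.v x ^ 2 + u.N x ^ 2) +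
      β * (u.v1 x ^ 2 + u.N1 x ^ 2)) unitVol := h1.add h2
  unfold dom
  rw [integral_add h12 h3, integral_add h1 h2, integral_const_mul, integral_const_mul,
    integral_const_mul, integral_add hu.v.memLp.integrable_sq hu.N.memLp.integrable_sq,
    integral_add hu.v1.memLp.integrable_sq hu.N1.memLp.integrable_sq,
    integral_add hu.g.integrable_sq hu.f.integrable_sq]

theorem integral_dom_le (hu : u.IsMode a r s) (hB : u.IsBounded B) (hs : 1 ≤ s) (hm : 0 < m)
    (ha : IsCoef m K a a') (hr : IsCoef m K r r') {α β γ : ℝ} (hα : 0 ≤ α) (hβ : 0 ≤ β)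
    (hγ : 0 ≤ γ) :
    ∫ x, u.dom α β γ x ∂unitVol ≤ 2 * α * B + 2 * β * (derivBound K B * s ^ 2) + 2 * γ * B := by
  obtain ⟨⟨h1, h2⟩, -⟩ := hu.derivative_bounds hB hs hm ha hr
  rw [hu.integral_dom]
  have e1 := mul_le_mul_of_nonneg_left (add_le_add hB.v hB.N) hα
  have e2 := mul_le_mul_of_nonneg_left (add_le_add h1 h2) hβ
  have e3 := mul_le_mul_of_nonneg_left (add_le_add hB.g hB.f) hγ
  linarith

/-- Pointwise bound for a quantity dominated together with its derivative. -/
theorem abs_le_of_dom (hu : u.IsMode a r s) (hB : u.IsBounded B) (hs : 1 ≤ s) (hm : 0 < m)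
    (ha : IsCoef m K a a') (hr : IsCoef m K r r') {α β γ α' β' γ' : ℝ} (hα : 0 ≤ α) (hβ : 0 ≤ β)
    (hγ : 0 ≤ γ) (hα' : 0 ≤ α') (hβ' : 0 ≤ β') (hγ' : 0 ≤ γ') {G G' : ℝ → ℝ} (hG : ACDeriv G G')
    (h1 : ∀ᵐ t ∂unitVol, |G t| ≤ u.dom α β γ t) (h2 : ∀ᵐ t ∂unitVol, |G' t| ≤ u.dom α' β' γ' t)
    {t : ℝ} (ht : t ∈ Icc (0 : ℝ) 1) :
    |G t| ≤ 2 * (α + α') * B + 2 * (β + β') * (derivBound K B * s ^ 2) + 2 * (γ + γ') * B := by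
  have e1 := hG.abs_le (hu.integrable_dom α' β' γ') h2 ht
  have e2 := integral_mono_ae hG.integrable_self.abs (hu.integrable_dom α β γ) h1
  have e3 := hu.integral_dom_le hB hs hm ha hr hα hβ hγ
  have e4 := hu.integral_dom_le hB hs hm ha hr hα' hβ' hγ'
  linarith

end IsMode

/-! ### Almost conserved quantities on one beam. -/

/-- The first almost conserved quantity. -/
noncomputable def energy (u : BeamState) (a r : ℝ → ℝ) (s : ℝ) (t : ℝ) : ℝ :=
  a t * u.N t ^ 2 + r t * u.v t ^ 2 - 2 / s ^ 2 * (u.v1 t * u.N1 t)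

/-- The second almost conserved quantity. -/
noncomputable def derivEnergy (u : BeamState) (a r : ℝ → ℝ) (s : ℝ) (t : ℝ) : ℝ :=
  r t * u.v1 t ^ 2 + a t * u.N1 t ^ 2 - 2 * s ^ 2 * (a t * r t * (u.v t * u.N t))

/-- The derivative of the product `v N`. -/
def prodDeriv (u : BeamState) (t : ℝ) : ℝ := u.v1 t * u.N t + u.v t * u.N1 t

namespace IsMode

/-- The factor 2/s² makes 2aNN' + 2rvv' cancel against the main part of (v'N')'. -/
theorem acDeriv_energy (hu : u.IsMode a r s) (hs : 1 ≤ s) (ha : ACDeriv a a') (hr : ACDeriv r r') :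
    ACDeriv (u.energy a r s) (fun t => a' t * u.N t ^ 2 + r' t * u.v t ^ 2
      - 2 / s ^ 2 * (u.g t * u.N1 t + u.f t * u.v1 t)) := by
  have h := ((ha.mul (hu.N.mul hu.N)).add (hr.mul (hu.v.mul hu.v))).add
    ((hu.v1.mul hu.N1).const_mul (-(2 / s ^ 2)))
  have s0 : s ≠ 0 := by linarith
  have h' := h.congr (g' := fun t => a' t * u.N t ^ 2 + r' t * u.v t ^ 2
      - 2 / s ^ 2 * (u.g t * u.N1 t + u.f t * u.v1 t)) (ae_of_all _ fun t => by field_simp; ring)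
  convert h' using 2 with t
  unfold energy
  ring

/-- Here 2rv'v'' + 2aN'N'' equals 2s²ar(vN)' up to forcing and cancels; the surviving terms are
O(s²) in L¹. -/
theorem acDeriv_derivEnergy (hu : u.IsMode a r s) (ha : ACDeriv a a') (hr : ACDeriv r r') :
    ACDeriv (u.derivEnergy a r s) (fun t => r' t * u.v1 t ^ 2 + a' t * u.N1 t ^ 2
      - 2 * s ^ 2 * ((a' t * r t + a t * r' t) * (u.v t * u.N t))
      + 2 * (r t * (u.v1 t * u.g t) + a t * (u.N1 t * u.f t))) := by
  have h := ((hr.mul (hu.v1.mul hu.v1)).add (ha.mul (hu.N1.mul hu.N1))).add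
    (((ha.mul hr).mul (hu.v.mul hu.N)).const_mul (-(2 * s ^ 2)))
  have h' := h.congr (g' := fun t => r' t * u.v1 t ^ 2 + a' t * u.N1 t ^ 2
      - 2 * s ^ 2 * ((a' t * r t + a t * r' t) * (u.v t * u.N t))
      + 2 * (r t * (u.v1 t * u.g t) + a t * (u.N1 t * u.f t))) (ae_of_all _ fun t => by ring)
  convert h' using 2 with t
  unfold derivEnergy
  ring

/-- Substituting 2v'N' = s²(aN² + rv² - E) doubles the positive quadratic term. Both the boundary
layer inequality and the multiplier estimate rest on this identity. -/
theorem acDeriv_prodDeriv (hu : u.IsMode a r s) (hs : 1 ≤ s) :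
    ACDeriv u.prodDeriv (fun t => 2 * s ^ 2 * (a t * u.N t ^ 2 + r t * u.v t ^ 2)
      - s ^ 2 * u.energy a r s t + (u.g t * u.N t + u.f t * u.v t)) := by
  have s0 : s ≠ 0 := by linarith
  refine ((hu.v1.mul hu.N).add (hu.v.mul hu.N1)).congr (ae_of_all _ fun t => ?_)
  unfold energy
  field_simp
  ring

/-- E and E' are both O(1) in L¹, because the weight 1/s² compensates the L² size s of v' and N'.
Inserting the pointwise trace bounds into E directly would only give O(s). -/
theorem energy_bound (hu : u.IsMode a r s) (hB : u.IsBounded B) (hs : 1 ≤ s) (hm : 0 < m)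
    (ha : IsCoef m K a a') (hr : IsCoef m K r r') {t : ℝ} (ht : t ∈ Icc (0 : ℝ) 1) :
    |u.energy a r s t| ≤ (4 * K + 2) * B + 4 * derivBound K B := by
  have s0 : 0 < s := by linarith
  have s2 : 1 ≤ s ^ 2 := one_le_pow₀ hs
  have hK : 0 ≤ K := by
    have := ha.lower 0 (by simp); have := ha.upper 0 (by simp); linarith
  have hD : 0 ≤ derivBound K B := by have := hB.nonneg; unfold derivBound; positivity
  have key : ∀ x y : ℝ, |2 / s ^ 2 * (x * y)| ≤ (x ^ 2 + y ^ 2) / s ^ 2 := by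
    intro x y
    rw [abs_mul, abs_of_pos (by positivity : 0 < 2 / s ^ 2), div_mul_eq_mul_div]
    gcongr
    rw [← abs_two, ← abs_mul, _root_.abs_le]
    constructor <;> nlinarith [sq_nonneg (x + y), sq_nonneg (x - y)]
  have key2 : ∀ x y : ℝ, |2 / s ^ 2 * (x * y)| ≤ x ^ 2 + y ^ 2 / s ^ 4 := by
    intro x y
    have e : 2 / s ^ 2 * (x * y) = 2 * (x * (y / s ^ 2)) := by field_simp
    have e' : y ^ 2 / s ^ 4 = (y / s ^ 2) ^ 2 := by field_simp
    rw [e, e', _root_.abs_le]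
    constructor <;> nlinarith [sq_nonneg (x + y / s ^ 2), sq_nonneg (x - y / s ^ 2)]
  have h := hu.abs_le_of_dom hB hs hm ha hr (α := K) (β := 1 / s ^ 2) (γ := 0) (α' := K)
    (β' := 1 / s ^ 2) (γ' := 1) hK (by positivity) le_rfl hK (by positivity) zero_le_one
    (hu.acDeriv_energy hs ha.acDeriv hr.acDeriv)
    (by
      filter_upwards [ae_restrict_mem measurableSet_Ioo] with x hx
      have hx' := Ioo_subset_Icc_self hx
      have a1 := ha.lower x hx'
      have a2 := ha.upper x hx'
      have r1 := hr.lower x hx'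
      have r2 := hr.upper x hx'
      have k1 := _root_.abs_le.1 (key (u.v1 x) (u.N1 x))
      have n1 : a x * u.N x ^ 2 ≤ K * u.N x ^ 2 := by gcongr
      have n2 : r x * u.v x ^ 2 ≤ K * u.v x ^ 2 := by gcongr
      have n3 : 0 ≤ a x * u.N x ^ 2 := mul_nonneg (by linarith) (sq_nonneg _)
      have n4 : 0 ≤ r x * u.v x ^ 2 := mul_nonneg (by linarith) (sq_nonneg _)
      have d1 : u.dom K (1 / s ^ 2) 0 x = K * u.v x ^ 2 + K * u.N x ^ 2 +
        (u.v1 x ^ 2 + u.N1 x ^ 2) / s ^ 2 := by unfold dom; ring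
      rw [d1, energy, _root_.abs_le]
      constructor <;> linarith)
    (by
      filter_upwards [ae_restrict_mem measurableSet_Ioo, ha.deriv_le, hr.deriv_le] with x hx da dr
      have k1 := _root_.abs_le.1 (key2 (u.g x) (u.N1 x))
      have k2 := _root_.abs_le.1 (key2 (u.f x) (u.v1 x))
      have n1 : |a' x * u.N x ^ 2| ≤ K * u.N x ^ 2 := by
        rw [abs_mul, abs_of_nonneg (sq_nonneg (u.N x))]; gcongr
      have n2 : |r' x * u.v x ^ 2| ≤ K * u.v x ^ 2 := by
        rw [abs_mul, abs_of_nonneg (sq_nonneg (u.v x))]; gcongr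
      rw [_root_.abs_le] at n1 n2
      have d1 : u.dom K (1 / s ^ 2) 1 x = K * u.v x ^ 2 + K * u.N x ^ 2 +
        (u.v1 x ^ 2 + u.N1 x ^ 2) / s ^ 2 + (u.g x ^ 2 + u.f x ^ 2) := by unfold dom; ring
      have l1 : ∀ y : ℝ, y ^ 2 / s ^ 4 ≤ y ^ 2 / s ^ 2 := fun y => by
        gcongr
        norm_num
      have := l1 (u.v1 x)
      have := l1 (u.N1 x)
      rw [d1, mul_add, add_div, _root_.abs_le]
      constructor <;> linarith) ht
  have e : 2 * (1 / s ^ 2 + 1 / s ^ 2) * (derivBound K B * s ^ 2) = 4 * derivBound K B := by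
    field_simp; ring
  rw [e] at h
  linarith

theorem derivEnergy_bound (hu : u.IsMode a r s) (hB : u.IsBounded B) (hs : 1 ≤ s) (hm : 0 < m)
    (ha : IsCoef m K a a') (hr : IsCoef m K r r') {t : ℝ} (ht : t ∈ Icc (0 : ℝ) 1) :
    |u.derivEnergy a r s t| ≤ ((6 * K ^ 2 + 2 * K) * B + 6 * K * derivBound K B) * s ^ 2 := by
  have s0 : 0 < s := by linarith
  have s2 : 1 ≤ s ^ 2 := one_le_pow₀ hs
  have hK : 0 ≤ K := by
    have := ha.lower 0 (by simp); have := ha.upper 0 (by simp); linarith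
  have hB0 := hB.nonneg
  have key : ∀ x y : ℝ, |2 * (x * y)| ≤ x ^ 2 + y ^ 2 := by
    intro x y
    rw [_root_.abs_le]
    constructor <;> nlinarith [sq_nonneg (x + y), sq_nonneg (x - y)]
  have h := hu.abs_le_of_dom hB hs hm ha hr (α := s ^ 2 * K ^ 2) (β := K) (γ := 0)
    (α' := 2 * s ^ 2 * K ^ 2) (β' := 2 * K) (γ' := K) (by positivity) hK le_rfl (by positivity)
    (by positivity) hK (hu.acDeriv_derivEnergy ha.acDeriv hr.acDeriv)
    (by
      filter_upwards [ae_restrict_mem measurableSet_Ioo] with x hx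
      have hx' := Ioo_subset_Icc_self hx
      have a1 := ha.lower x hx'
      have a2 := ha.upper x hx'
      have r1 := hr.lower x hx'
      have r2 := hr.upper x hx'
      have a0 : 0 ≤ a x := by linarith
      have r0 : 0 ≤ r x := by linarith
      have n1 : a x * u.N1 x ^ 2 ≤ K * u.N1 x ^ 2 := by gcongr
      have n2 : r x * u.v1 x ^ 2 ≤ K * u.v1 x ^ 2 := by gcongr
      have n3 : 0 ≤ a x * u.N1 x ^ 2 := by positivity
      have n4 : 0 ≤ r x * u.v1 x ^ 2 := by positivity
      have n5 : |2 * s ^ 2 * (a x * r x * (u.v x * u.N x))| ≤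
          s ^ 2 * K ^ 2 * (u.v x ^ 2 + u.N x ^ 2) := by
        have e : 2 * s ^ 2 * (a x * r x * (u.v x * u.N x)) =
          s ^ 2 * (a x * r x) * (2 * (u.v x * u.N x)) := by ring
        rw [e, abs_mul, abs_of_nonneg (by positivity : 0 ≤ s ^ 2 * (a x * r x)), pow_two K]
        gcongr
        exact key _ _
      rw [_root_.abs_le] at n5
      have d1 : u.dom (s ^ 2 * K ^ 2) K 0 x = s ^ 2 * K ^ 2 * (u.v x ^ 2 + u.N x ^ 2) +
        (K * u.v1 x ^ 2 + K * u.N1 x ^ 2) := by unfold dom; ring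
      rw [d1, derivEnergy, _root_.abs_le]
      constructor <;> linarith)
    (by
      filter_upwards [ae_restrict_mem measurableSet_Ioo, ha.deriv_le, hr.deriv_le] with x hx da dr
      have hx' := Ioo_subset_Icc_self hx
      have a1 := ha.lower x hx'
      have a2 := ha.upper x hx'
      have r1 := hr.lower x hx'
      have r2 := hr.upper x hx'
      have a0 : 0 ≤ a x := by linarith
      have r0 : 0 ≤ r x := by linarith
      have n1 : |a' x * u.N1 x ^ 2| ≤ K * u.N1 x ^ 2 := by
        rw [abs_mul, abs_of_nonneg (sq_nonneg (u.N1 x))]; gcongr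
      have n2 : |r' x * u.v1 x ^ 2| ≤ K * u.v1 x ^ 2 := by
        rw [abs_mul, abs_of_nonneg (sq_nonneg (u.v1 x))]; gcongr
      have n3 : |r x * (2 * (u.v1 x * u.g x))| ≤ K * (u.v1 x ^ 2 + u.g x ^ 2) := by
        rw [abs_mul, abs_of_nonneg r0]; gcongr; exact key _ _
      have n4 : |a x * (2 * (u.N1 x * u.f x))| ≤ K * (u.N1 x ^ 2 + u.f x ^ 2) := by
        rw [abs_mul, abs_of_nonneg a0]; gcongr; exact key _ _
      have n6 : |a' x * r x + a x * r' x| ≤ 2 * K ^ 2 := by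
        refine (abs_add_le _ _).trans ?_
        rw [abs_mul, abs_mul, abs_of_nonneg r0, abs_of_nonneg a0]
        have q1 : |a' x| * r x ≤ K * K := by gcongr
        have q2 : a x * |r' x| ≤ K * K := by gcongr
        linarith
      have n5 : |2 * s ^ 2 * ((a' x * r x + a x * r' x) * (u.v x * u.N x))| ≤
          s ^ 2 * (2 * K ^ 2) * (u.v x ^ 2 + u.N x ^ 2) := by
        have e : 2 * s ^ 2 * ((a' x * r x + a x * r' x) * (u.v x * u.N x)) =
          s ^ 2 * (a' x * r x + a x * r' x) * (2 * (u.v x * u.N x)) := by ring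
        rw [e, abs_mul, abs_mul, abs_of_nonneg (by positivity : 0 ≤ s ^ 2)]
        gcongr
        exact key _ _
      rw [_root_.abs_le] at n1 n2 n3 n4 n5
      have d1 : u.dom (2 * s ^ 2 * K ^ 2) (2 * K) K x =
          s ^ 2 * (2 * K ^ 2) * (u.v x ^ 2 + u.N x ^ 2) + (2 * K * u.v1 x ^ 2 + 2 * K * u.N1 x ^ 2)
          + (K * u.g x ^ 2 + K * u.f x ^ 2) := by unfold dom; ring
      rw [d1, _root_.abs_le]
      constructor <;> linarith) ht
  have e : K * B ≤ K * B * s ^ 2 := le_mul_of_one_le_right (by positivity) s2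
  linarith

end IsMode
end BeamState

/-! ### Boundary layers: the sign and growth of the product vN. -/

namespace BeamState

variable {u : BeamState} {a a' r r' : ℝ → ℝ} {s m K B : ℝ}

namespace IsMode

/-- All traces are controlled by the positive part of the product `v N`. -/
theorem exists_trace_bound (hm : 0 < m) (K B : ℝ) : ∃ C, 0 ≤ C ∧
    ∀ (u : BeamState) (a a' r r' : ℝ → ℝ) (s : ℝ), u.IsMode a r s → u.IsBounded B → 1 ≤ s →
      IsCoef m K a a' → IsCoef m K r r' → ∀ t ∈ Icc (0 : ℝ) 1,
      u.v t ^ 2 + u.N t ^ 2 ≤ C * (1 + max (u.v t * u.N t) 0) ∧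
      u.v1 t ^ 2 + u.N1 t ^ 2 ≤ C * (1 + max (u.v t * u.N t) 0) * s ^ 2 := by
  set CE := |(4 * K + 2) * B + 4 * derivBound K B|
  set CF := |(6 * K ^ 2 + 2 * K) * B + 6 * K * derivBound K B|
  -- `C₁` comes from the second quantity, m(v'² + N'²) ≤ CF s² + 2s²arvN, where a negative vN only
  -- helps. `C₂` then comes from the first, since 2s⁻²v'N' ≤ s⁻²(v'² + N'²).
  set C₁ := (CF + 2 * K ^ 2) / m with hC₁
  set C₂ := (CE + C₁) / m with hC₂
  have c1 : 0 ≤ C₁ := by positivity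
  have c2 : 0 ≤ C₂ := by positivity
  refine ⟨C₁ + C₂, by positivity, fun u a a' r r' s hu hB hs ha hr t ht => ?_⟩
  set P := max (u.v t * u.N t) 0
  have P0 : 0 ≤ P := le_max_right _ _
  have Pw : u.v t * u.N t ≤ P := le_max_left _ _
  have s0 : 0 < s := by linarith
  have hE := (le_abs_self _).trans ((hu.energy_bound hB hs hm ha hr ht).trans (le_abs_self _))
  have hF := (le_abs_self _).trans (hu.derivEnergy_bound hB hs hm ha hr ht)
  have hF' : u.derivEnergy a r s t ≤ CF * s ^ 2 := hF.trans (by gcongr; exact le_abs_self _)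
  have a1 := ha.lower t ht
  have a2 := ha.upper t ht
  have r1 := hr.lower t ht
  have r2 := hr.upper t ht
  have a0 : 0 ≤ a t := by linarith
  have r0 : 0 ≤ r t := by linarith
  have K0 : 0 ≤ K := by linarith
  have h1 : u.v1 t ^ 2 + u.N1 t ^ 2 ≤ C₁ * (1 + P) * s ^ 2 := by
    have e1 : m * u.v1 t ^ 2 ≤ r t * u.v1 t ^ 2 := by gcongr
    have e2 : m * u.N1 t ^ 2 ≤ a t * u.N1 t ^ 2 := by gcongr
    have e3 : a t * r t * (u.v t * u.N t) ≤ K ^ 2 * P :=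
      calc _ ≤ a t * r t * P := by gcongr
        _ ≤ K * K * P := by gcongr
        _ = _ := by ring
    have e4 : s ^ 2 * (a t * r t * (u.v t * u.N t)) ≤ s ^ 2 * (K ^ 2 * P) := by gcongr
    have e5 : C₁ * (1 + P) * s ^ 2 = ((CF + 2 * K ^ 2) * (1 + P) * s ^ 2) / m := by
      rw [hC₁]; ring
    rw [e5, le_div_iff₀ hm]
    unfold derivEnergy at hF'
    have e6 : 0 ≤ CF * P * s ^ 2 := by positivity
    have e7 : 0 ≤ K ^ 2 * s ^ 2 := by positivity
    linarith
  refine ⟨?_, h1.trans (by gcongr; linarith)⟩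
  have h2 : u.v t ^ 2 + u.N t ^ 2 ≤ C₂ * (1 + P) := by
    have e1 : m * u.v t ^ 2 ≤ r t * u.v t ^ 2 := by gcongr
    have e2 : m * u.N t ^ 2 ≤ a t * u.N t ^ 2 := by gcongr
    have e3 : 2 / s ^ 2 * (u.v1 t * u.N1 t) ≤ C₁ * (1 + P) := by
      rw [div_mul_eq_mul_div, div_le_iff₀ (by positivity)]
      linarith [sq_nonneg (u.v1 t - u.N1 t)]
    have e5 : C₂ * (1 + P) = ((CE + C₁) * (1 + P)) / m := by
      rw [hC₂]; ring
    rw [e5, le_div_iff₀ hm]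
    unfold energy at hE
    have e6 : 0 ≤ CE * P := by positivity
    linarith
  exact h2.trans (by gcongr; linarith)

theorem acDeriv_prod (hu : u.IsMode a r s) : ACDeriv (fun t => u.v t * u.N t) u.prodDeriv :=
  hu.v.mul hu.N

theorem _root_.ACDeriv.exp_affine (p q : ℝ) :
    ACDeriv (fun t => Real.exp (p * t + q)) (fun t => p * Real.exp (p * t + q)) := by
  refine ACDeriv.of_contDiff (by fun_prop) fun t => ?_
  have h : HasDerivAt (fun t => p * t + q) (p * 1) t := ((hasDerivAt_id t).const_mul p).add_const q
  simpa [mul_comm] using h.exp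

/-- The differential inequality for the product `v N`. -/
theorem prod_convexity (hu : u.IsMode a r s) (hB : u.IsBounded B) (hs : 1 ≤ s) (hm : 0 < m)
    (hm1 : m ≤ 1) (ha : IsCoef m K a a') (hr : IsCoef m K r r') {t : ℝ} (ht : t ∈ Icc (0 : ℝ) 1) :
    (2 * m * s) ^ 2 * (u.v t * u.N t) - s ^ 2 * |(4 * K + 2) * B + 4 * derivBound K B|
      - u.dom 1 0 1 t ≤
    2 * s ^ 2 * (a t * u.N t ^ 2 + r t * u.v t ^ 2) - s ^ 2 * u.energy a r s t
      + (u.g t * u.N t + u.f t * u.v t) := by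
  have hE := (le_abs_self _).trans ((hu.energy_bound hB hs hm ha hr ht).trans (le_abs_self _))
  have a1 := ha.lower t ht
  have r1 := hr.lower t ht
  have e1 : m * u.v t ^ 2 ≤ r t * u.v t ^ 2 := by gcongr
  have e2 : m * u.N t ^ 2 ≤ a t * u.N t ^ 2 := by gcongr
  have e3 : s ^ 2 * u.energy a r s t ≤ s ^ 2 * |(4 * K + 2) * B + 4 * derivBound K B| := by gcongr
  -- The condition m ≤ 1 lowers the natural constant 4m to 4m², so that the exponential rate is
  -- simply 2ms.
  have e4 : (2 * m) ^ 2 * (u.v t * u.N t) ≤ 2 * (m * u.v t ^ 2 + m * u.N t ^ 2) := by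
    have q1 : 2 * |u.v t * u.N t| ≤ u.v t ^ 2 + u.N t ^ 2 := by
      rw [← abs_two, ← abs_mul, _root_.abs_le]
      constructor <;> nlinarith [sq_nonneg (u.v t + u.N t), sq_nonneg (u.v t - u.N t)]
    have q2 : m ^ 2 * (u.v t * u.N t) ≤ m * |u.v t * u.N t| := by
      have := le_abs_self (u.v t * u.N t)
      have q3 : m ^ 2 * (u.v t * u.N t) ≤ m ^ 2 * |u.v t * u.N t| := by gcongr
      have q4 : m ^ 2 * |u.v t * u.N t| ≤ m * |u.v t * u.N t| := by
        gcongr; nlinarith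
      linarith
    nlinarith
  have e5 : s ^ 2 * ((2 * m) ^ 2 * (u.v t * u.N t)) ≤
      s ^ 2 * (2 * (a t * u.N t ^ 2 + r t * u.v t ^ 2)) :=
    mul_le_mul_of_nonneg_left (by linarith) (sq_nonneg s)
  have e6 : -u.dom 1 0 1 t ≤ u.g t * u.N t + u.f t * u.v t := by
    unfold dom
    nlinarith [sq_nonneg (u.g t + u.N t), sq_nonneg (u.f t + u.v t), sq_nonneg (u.g t),
      sq_nonneg (u.N t), sq_nonneg (u.f t), sq_nonneg (u.v t)]
  linarith

/-- At the right end the product `v N` grows, at the left end it decays, up to bounded errors. -/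
theorem exists_layer_bound (hm : 0 < m) (hm1 : m ≤ 1) (K B : ℝ) : ∃ C, 0 ≤ C ∧
    ∀ (u : BeamState) (a a' r r' : ℝ → ℝ) (s : ℝ), u.IsMode a r s → u.IsBounded B → 1 ≤ s →
      IsCoef m K a a' → IsCoef m K r r' →
      (2 * m * s * (u.v 1 * u.N 1) - C * s ≤ u.prodDeriv 1 ∧
        u.prodDeriv 0 ≤ -(2 * m * s * (u.v 0 * u.N 0)) + C * s) := by
  set CE := |(4 * K + 2) * B + 4 * derivBound K B| with hCE
  set D := |derivBound K B|
  -- Chosen so that κ²δ = s² CE. The shifted product W = vN - δ then satisfies W'' ≥ κ²W - `dom 1 0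
  -- 1`, whose last term has bounded integral.
  set δ := CE / (4 * m ^ 2) with hδ
  refine ⟨2 * (1 + 2 * m) * |B| + 2 * D + 4 * m * δ + 4 * |B|, by positivity,
    fun u a a' r r' s hu hB hs ha hr => ?_⟩
  have s0 : 0 < s := by linarith
  set κ := 2 * m * s with hκ
  have κ0 : 0 < κ := by positivity
  have hδ' : κ ^ 2 * δ = s ^ 2 * CE := by rw [hδ, hκ]; field_simp; ring
  have δ0 : 0 ≤ δ := by positivity
  have hW := (hu.acDeriv_prod).add (ACDeriv.const (-δ))
  have hW1 := hu.acDeriv_prodDeriv hs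
  have hd0 : ∀ᵐ t ∂unitVol, 0 ≤ u.dom 1 0 1 t :=
    ae_of_all _ (u.dom_nonneg zero_le_one le_rfl zero_le_one)
  have hdi := hu.integrable_dom 1 0 1
  have hdb := hu.integral_dom_le hB hs hm ha hr (zero_le_one) le_rfl (zero_le_one (α := ℝ))
  have key : ∀ t ∈ Icc (0 : ℝ) 1, ∀ e : ℝ, 0 ≤ e → e ≤ 1 → -u.dom 1 0 1 t ≤
      e * (2 * s ^ 2 * (a t * u.N t ^ 2 + r t * u.v t ^ 2) - s ^ 2 * u.energy a r s t
      + (u.g t * u.N t + u.f t * u.v t) - κ ^ 2 * (u.v t * u.N t + -δ)) := by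
    intro t ht e e0 e1
    have h := hu.prod_convexity hB hs hm hm1 ha hr ht
    have d0 := u.dom_nonneg zero_le_one le_rfl (zero_le_one (α := ℝ)) t (α := 1)
    rw [← hCE, ← hκ] at h
    have h2 : e * -u.dom 1 0 1 t ≤ e * (2 * s ^ 2 * (a t * u.N t ^ 2 + r t * u.v t ^ 2)
        - s ^ 2 * u.energy a r s t + (u.g t * u.N t + u.f t * u.v t)
        - κ ^ 2 * (u.v t * u.N t + -δ)) := by
      gcongr; linarith
    nlinarith
  have hbd : ∀ t, ∀ e : ℝ, 0 ≤ e → e ≤ 1 → ∀ σ : ℝ, |σ| = 1 →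
      |e * (u.prodDeriv t + σ * κ * (u.v t * u.N t + -δ))| ≤
        u.dom (s + κ) (1 / s) 0 t + κ * δ := by
    intro t e e0 e1 σ hσ
    have q : ∀ x y : ℝ, |x * y| ≤ (1 / s) * x ^ 2 + s * y ^ 2 := by
      intro x y
      have : (1 / s) * x ^ 2 + s * y ^ 2 = (x ^ 2 + (s * y) ^ 2) / s := by field_simp
      rw [this, le_div_iff₀ s0, ← abs_of_pos s0, ← abs_mul, _root_.abs_le, abs_of_pos s0]
      constructor <;> nlinarith [sq_nonneg (x + s * y), sq_nonneg (x - s * y)]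
    have q1 := q (u.v1 t) (u.N t)
    have q2 := q (u.N1 t) (u.v t)
    have q3 : |u.v t * u.N t| ≤ u.v t ^ 2 + u.N t ^ 2 := by
      rw [_root_.abs_le]
      constructor <;> nlinarith [sq_nonneg (u.v t + u.N t), sq_nonneg (u.v t - u.N t)]
    have q4 : |u.v t * u.N t + -δ| ≤ u.v t ^ 2 + u.N t ^ 2 + δ := by
      refine (abs_add_le _ _).trans ?_
      rw [abs_neg, abs_of_nonneg δ0]; linarith
    rw [abs_mul, abs_of_nonneg e0]
    have q5 : |u.prodDeriv t + σ * κ * (u.v t * u.N t + -δ)| ≤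
        u.dom (s + κ) (1 / s) 0 t + κ * δ := by
      refine (abs_add_le _ _).trans ?_
      rw [abs_mul, abs_mul, hσ, one_mul, abs_of_pos κ0]
      have q6 : κ * |u.v t * u.N t + -δ| ≤ κ * (u.v t ^ 2 + u.N t ^ 2 + δ) := by gcongr
      have q7 : |u.prodDeriv t| ≤ |u.v1 t * u.N t| + |u.N1 t * u.v t| := by
        unfold prodDeriv; rw [mul_comm (u.v t)]; exact abs_add_le _ _
      unfold dom
      linarith
    calc _ ≤ 1 * |u.prodDeriv t + σ * κ * (u.v t * u.N t + -δ)| := by gcongr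
      _ ≤ _ := by rwa [one_mul]
  have hint : ∫ t, (u.dom (s + κ) (1 / s) 0 t + κ * δ) ∂unitVol ≤
      (2 * (1 + 2 * m) * |B| + 2 * D + 2 * m * δ) * s := by
    rw [integral_add (hu.integrable_dom _ _ _) (integrable_const _)]
    have h := hu.integral_dom_le hB hs hm ha hr (α := s + κ) (β := 1 / s) (γ := 0)
      (by positivity) (by positivity) le_rfl
    have e : 2 * (1 / s) * (derivBound K B * s ^ 2) = 2 * (derivBound K B * s) := by field_simp
    have e1 : derivBound K B * s ≤ D * s := by gcongr; exact le_abs_self _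
    have e2 : (s + κ) * B ≤ (s + κ) * |B| := by gcongr; exact le_abs_self _
    rw [e] at h
    simp only [integral_const, MeasurableSet.univ, measureReal_restrict_apply, univ_inter,
      Real.volume_real_Ioo, sub_zero, zero_le_one, sup_of_le_left, smul_eq_mul, one_mul]
    have : s + κ = s * (1 + 2 * m) := by rw [hκ]; ring
    have : κ * δ = 2 * m * δ * s := by rw [hκ]; ring
    nlinarith
  have hdb' : ∫ t, u.dom 1 0 1 t ∂unitVol ≤ 4 * |B| * s := by
    have e1 : B ≤ |B| := le_abs_self _
    have e2 : |B| * 1 ≤ |B| * s := by gcongr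
    linarith
  have hκδ : κ * δ = 2 * m * δ * s := by rw [hκ]; ring
  have hIi : Integrable (fun t => u.dom (s + κ) (1 / s) 0 t + κ * δ) unitVol :=
    (hu.integrable_dom _ _ _).add (integrable_const _)
  constructor
  -- Factorisation of W'' - κ²W: the function exp(κ(t - 1))(W' - κW) has derivative exp(κ(t -
  -- 1))(W'' - κ²W). Its weight is 1 at t = 1 and at most 1 elsewhere, and its L¹ norm is O(s). At
  -- the left end the factor exp(-κt)(W' + κW) plays this role.
  · have hG := (ACDeriv.exp_affine κ (-κ)).mul (hW1.add (hW.const_mul (-1 * κ)))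
    have hexp : ∀ t ∈ Icc (0 : ℝ) 1, Real.exp (κ * t + -κ) ≤ 1 := fun t ht => by
      rw [Real.exp_le_one_iff]; nlinarith [ht.2]
    have h := hG.le_right hdi hd0 (by
      filter_upwards [ae_restrict_mem measurableSet_Ioo] with t ht
      have ht' := Ioo_subset_Icc_self ht
      refine (key t ht' _ (Real.exp_pos _).le (hexp t ht')).trans (le_of_eq ?_)
      unfold prodDeriv
      ring)
    have hI := integral_mono_ae hG.integrable_self.abs hIi (by
      filter_upwards [ae_restrict_mem measurableSet_Ioo] with t ht
      have ht' := Ioo_subset_Icc_self ht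
      exact hbd t _ (Real.exp_pos _).le (hexp t ht') (-1) (by simp))
    simp only [mul_one, add_neg_cancel, Real.exp_zero, one_mul] at h
    have : 0 ≤ 2 * m * δ * s := by positivity
    linarith
  · have hG := (ACDeriv.exp_affine (-κ) 0).mul (hW1.add (hW.const_mul (1 * κ)))
    have hexp : ∀ t ∈ Icc (0 : ℝ) 1, Real.exp (-κ * t + 0) ≤ 1 := fun t ht => by
      rw [Real.exp_le_one_iff]; nlinarith [ht.1]
    have h := hG.left_le hdi hd0 (by
      filter_upwards [ae_restrict_mem measurableSet_Ioo] with t ht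
      have ht' := Ioo_subset_Icc_self ht
      refine (key t ht' _ (Real.exp_pos _).le (hexp t ht')).trans (le_of_eq ?_)
      unfold prodDeriv
      ring)
    have hI := integral_mono_ae hG.integrable_self.abs hIi (by
      filter_upwards [ae_restrict_mem measurableSet_Ioo] with t ht
      have ht' := Ioo_subset_Icc_self ht
      exact hbd t _ (Real.exp_pos _).le (hexp t ht') 1 (by simp))
    simp only [mul_zero, add_zero, Real.exp_zero, one_mul] at h hI
    have : 0 ≤ 2 * m * δ * s := by positivity
    linarith

end IsMode

/-! ### The multiplier estimate on one beam. -/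

/-- The boundary functional of the multiplier method for the weight `A - P exp(-θ t)`. -/
noncomputable def flux (u : BeamState) (a r : ℝ → ℝ) (s A P θ : ℝ) (t : ℝ) : ℝ :=
  (A - P * Real.exp (-θ * t)) * u.energy a r s t
    + θ * P * Real.exp (-θ * t) * u.prodDeriv t / s ^ 2

theorem abs_mul_le_weighted {l : ℝ} (hl : 0 < l) (y z : ℝ) :
    |y * z| ≤ (l * y ^ 2 + z ^ 2 / l) / 2 := by
  have : (l * y ^ 2 + z ^ 2 / l) / 2 = ((l * y) ^ 2 + z ^ 2) / 2 / l := by field_simp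
  rw [this, le_div_iff₀ hl, mul_comm, ← abs_of_pos hl, ← abs_mul, _root_.abs_le, abs_of_pos hl]
  constructor <;> nlinarith [sq_nonneg (l * y + z), sq_nonneg (l * y - z)]

/-- This and the next two bounds treat the error terms in the derivative of `flux`. The weights 1/s³
on v'², N'² and 1/s on v², N² make their integrals O(1/s); g² and f² may keep a fixed weight because
their integrals tend to zero. -/
theorem rhs_term_le (hs : 1 ≤ s) {q P v1 N1 g f : ℝ} (hq : |q| ≤ P) :
    |2 * q / s ^ 2 * (g * N1 + f * v1)| ≤
      P * ((g ^ 2 + f ^ 2) + 1 / s ^ 3 * (v1 ^ 2 + N1 ^ 2)) := by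
  have s0 : 0 < s := by linarith
  have P0 : 0 ≤ P := (abs_nonneg _).trans hq
  have s4 : 1 / s ^ 4 ≤ 1 / s ^ 3 := by
    gcongr
    · norm_num
  have k3 : |g * N1 + f * v1| ≤
      s ^ 2 / 2 * ((g ^ 2 + f ^ 2) + 1 / s ^ 4 * (v1 ^ 2 + N1 ^ 2)) := by
    refine (abs_add_le _ _).trans ((add_le_add
      (abs_mul_le_weighted (l := s ^ 2) (by positivity) g N1)
      (abs_mul_le_weighted (l := s ^ 2) (by positivity) f v1)).trans (le_of_eq ?_))
    field_simp
    ring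
  rw [abs_mul, abs_div, abs_mul, abs_two, abs_of_pos (by positivity : 0 < s ^ 2)]
  calc 2 * |q| / s ^ 2 * |g * N1 + f * v1|
      ≤ 2 * P / s ^ 2 * (s ^ 2 / 2 * ((g ^ 2 + f ^ 2) + 1 / s ^ 4 * (v1 ^ 2 + N1 ^ 2))) := by
        gcongr
    _ = P * ((g ^ 2 + f ^ 2) + 1 / s ^ 4 * (v1 ^ 2 + N1 ^ 2)) := by field_simp
    _ ≤ _ := by gcongr

theorem cross_term_le (hs : 1 ≤ s) {q P v v1 N N1 : ℝ} (hq0 : 0 ≤ q) (hq : q ≤ P) :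
    |q / s ^ 2 * (v1 * N + v * N1)| ≤
      P * (1 / s * (v ^ 2 + N ^ 2) + 1 / s ^ 3 * (v1 ^ 2 + N1 ^ 2)) := by
  have s0 : 0 < s := by linarith
  have P0 : 0 ≤ P := hq0.trans hq
  have k3 : |v1 * N + v * N1| ≤
      s ^ 2 / 2 * (1 / s * (v ^ 2 + N ^ 2) + 1 / s ^ 3 * (v1 ^ 2 + N1 ^ 2)) := by
    rw [mul_comm v1]
    refine (abs_add_le _ _).trans ((add_le_add (abs_mul_le_weighted s0 N v1)
      (abs_mul_le_weighted s0 v N1)).trans (le_of_eq ?_))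
    field_simp
    ring
  rw [abs_mul, abs_of_nonneg (by positivity)]
  calc q / s ^ 2 * |v1 * N + v * N1|
      ≤ P / s ^ 2 * (s ^ 2 / 2 *
        (1 / s * (v ^ 2 + N ^ 2) + 1 / s ^ 3 * (v1 ^ 2 + N1 ^ 2))) := by gcongr
    _ = P * (1 / s * (v ^ 2 + N ^ 2) + 1 / s ^ 3 * (v1 ^ 2 + N1 ^ 2)) / 2 := by field_simp
    _ ≤ _ := half_le_self (by positivity)

theorem forcing_term_le (hs : 1 ≤ s) {q P v N g f : ℝ} (hq0 : 0 ≤ q) (hq : q ≤ P) :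
    |q / s ^ 2 * (g * N + f * v)| ≤ P * (1 / s * (v ^ 2 + N ^ 2) + (g ^ 2 + f ^ 2)) := by
  have s0 : 0 < s := by linarith
  have P0 : 0 ≤ P := hq0.trans hq
  have s1 : 1 / s ^ 2 ≤ 1 := by
    rw [div_le_one (by positivity)]; exact one_le_pow₀ hs
  have s2 : 1 / s ^ 2 ≤ 1 / s := by
    gcongr; nlinarith
  have k3 : |g * N + f * v| ≤ (v ^ 2 + N ^ 2) + (g ^ 2 + f ^ 2) := by
    have k1 := abs_mul_le_weighted one_pos g N
    have k2 := abs_mul_le_weighted one_pos f v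
    refine (abs_add_le _ _).trans ?_
    have := sq_nonneg v; have := sq_nonneg N
    have := sq_nonneg g; have := sq_nonneg f
    linarith
  rw [abs_mul, abs_of_nonneg (by positivity)]
  calc q / s ^ 2 * |g * N + f * v|
      ≤ P / s ^ 2 * ((v ^ 2 + N ^ 2) + (g ^ 2 + f ^ 2)) := by gcongr
    _ = P * (1 / s ^ 2 * (v ^ 2 + N ^ 2) + 1 / s ^ 2 * (g ^ 2 + f ^ 2)) := by ring
    _ ≤ P * (1 / s * (v ^ 2 + N ^ 2) + 1 * (g ^ 2 + f ^ 2)) := by gcongr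
    _ = _ := by ring

/-- Coercivity: θp stands for q' and d for the derivative of the coefficient y. Since |q| ≤ p, a
large θ lets 2q'y dominate qd. -/
theorem main_term_ge {q P₀ p θ y z d : ℝ} (hy : m ≤ y) (hd : |d| ≤ K) (hθ : 0 ≤ θ)
    (hp : 0 ≤ p) (hP₀ : P₀ ≤ p) (hq : |q| ≤ p) (hmθ : 1 ≤ 2 * θ * m - K) :
    P₀ * z ^ 2 ≤ 2 * (θ * p) * (y * z ^ 2) + q * (d * z ^ 2) := by
  have c1 : |q * d| ≤ p * K := by
    rw [abs_mul]; gcongr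
  have c2 : θ * p * m ≤ θ * p * y := by gcongr
  have c3 : p * 1 ≤ p * (2 * θ * m - K) := by gcongr
  have c4 : P₀ ≤ 2 * (θ * p) * y + q * d := by linarith [(_root_.abs_le.1 c1).1]
  have := mul_le_mul_of_nonneg_right c4 (sq_nonneg z)
  linarith

/-- Lower bound for the derivative of `BeamState.flux`. -/
theorem flux_deriv_ge {x A P θ e e₁ : ℝ} (hs : 1 ≤ s) (a1 : m ≤ a x) (r1 : m ≤ r x)
    (da : |a' x| ≤ K) (dr : |r' x| ≤ K) (hA : 0 ≤ A) (hAP : A ≤ P * e₁) (hθ : 0 ≤ θ)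
    (hmθ : 1 ≤ 2 * θ * m - K) (he₁ : 0 < e₁) (h1e : e₁ ≤ e) (he : e ≤ 1) :
    u.dom (P * e₁ - P * (θ + θ ^ 2) / s) (-(P * (1 + θ ^ 2) / s ^ 3)) (-(P * (1 + θ))) x ≤
      (0 + -P * (-θ * e)) * u.energy a r s x + (A + -P * e) *
        (a' x * u.N x ^ 2 + r' x * u.v x ^ 2 - 2 / s ^ 2 * (u.g x * u.N1 x + u.f x * u.v1 x)) +
      θ * P / s ^ 2 * (-θ * e * u.prodDeriv x + e *
        (2 * s ^ 2 * (a x * u.N x ^ 2 + r x * u.v x ^ 2) - s ^ 2 * u.energy a r s x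
          + (u.g x * u.N x + u.f x * u.v x))) := by
  have s0 : 0 < s := by linarith
  have P0 : 0 ≤ P := nonneg_of_mul_nonneg_left (hA.trans hAP) he₁
  have e0 : 0 ≤ e := he₁.le.trans h1e
  have Pe : P * e₁ ≤ P * e := by gcongr
  have qa : |A - P * e| ≤ P * e := by
    rw [_root_.abs_le]; constructor <;> linarith
  have Pe0 : 0 ≤ P * e := by positivity
  have Pe1 : P * e ≤ P := mul_le_of_le_one_right P0 he
  have t1 := main_term_ge (z := u.N x) a1 da hθ Pe0 Pe qa hmθ
  have t1' := main_term_ge (z := u.v x) r1 dr hθ Pe0 Pe qa hmθ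
  have t2 := (_root_.abs_le.1 (rhs_term_le hs (v1 := u.v1 x) (N1 := u.N1 x) (g := u.g x)
    (f := u.f x) (qa.trans Pe1))).2
  have t3 := (_root_.abs_le.1 (cross_term_le hs (v := u.v x) (v1 := u.v1 x) (N := u.N x)
    (N1 := u.N1 x) (q := θ ^ 2 * (P * e)) (P := θ ^ 2 * P) (by positivity)
    (by gcongr))).2
  have t4 := (_root_.abs_le.1 (forcing_term_le hs (v := u.v x) (N := u.N x) (g := u.g x)
    (f := u.f x) (q := θ * (P * e)) (P := θ * P) (by positivity) (by gcongr))).1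
  have hd : u.dom (P * e₁ - P * (θ + θ ^ 2) / s) (-(P * (1 + θ ^ 2) / s ^ 3))
      (-(P * (1 + θ))) x =
      P * e₁ * u.v x ^ 2 + P * e₁ * u.N x ^ 2
      - P * ((u.g x ^ 2 + u.f x ^ 2) + 1 / s ^ 3 * (u.v1 x ^ 2 + u.N1 x ^ 2))
      - θ ^ 2 * P * (1 / s * (u.v x ^ 2 + u.N x ^ 2) + 1 / s ^ 3 * (u.v1 x ^ 2 + u.N1 x ^ 2))
      - θ * P * (1 / s * (u.v x ^ 2 + u.N x ^ 2) + (u.g x ^ 2 + u.f x ^ 2)) := by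
    unfold dom; ring
  -- The term q'E from differentiating the weight cancels the -s²E contained in (vN)''.
  have goal_eq : (0 + -P * (-θ * e)) * u.energy a r s x + (A + -P * e) *
        (a' x * u.N x ^ 2 + r' x * u.v x ^ 2 - 2 / s ^ 2 * (u.g x * u.N1 x + u.f x * u.v1 x)) +
      θ * P / s ^ 2 * (-θ * e * u.prodDeriv x + e *
        (2 * s ^ 2 * (a x * u.N x ^ 2 + r x * u.v x ^ 2) - s ^ 2 * u.energy a r s x
          + (u.g x * u.N x + u.f x * u.v x))) =
      (2 * (θ * (P * e)) * (a x * u.N x ^ 2) + (A - P * e) * (a' x * u.N x ^ 2))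
      + (2 * (θ * (P * e)) * (r x * u.v x ^ 2) + (A - P * e) * (r' x * u.v x ^ 2))
      - 2 * (A - P * e) / s ^ 2 * (u.g x * u.N1 x + u.f x * u.v1 x)
      - θ ^ 2 * (P * e) / s ^ 2 * (u.v1 x * u.N x + u.v x * u.N1 x)
      + θ * (P * e) / s ^ 2 * (u.g x * u.N x + u.f x * u.v x) := by
    unfold prodDeriv
    field_simp
    ring
  rw [goal_eq, hd]
  linarith

/-- The minimum of exp(-θt) on the beam is exp(-θ). Thus A ≤ P exp(-θ) makes the weight A - P
exp(-θt) nonpositive throughout, and 0 ≤ A bounds its modulus by P exp(-θt). -/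
theorem IsMode.flux_bound (hu : u.IsMode a r s) (hB : u.IsBounded B) (hs : 1 ≤ s) (hm : 0 < m)
    (ha : IsCoef m K a a') (hr : IsCoef m K r r') {A P θ : ℝ} (hA : 0 ≤ A)
    (hAP : A ≤ P * Real.exp (-θ)) (hθ : 0 ≤ θ) (hmθ : 1 ≤ 2 * θ * m - K) :
    P * Real.exp (-θ) * (∫ x, u.v x ^ 2 ∂unitVol + ∫ x, u.N x ^ 2 ∂unitVol) ≤
      u.flux a r s A P θ 1 - u.flux a r s A P θ 0
      + 2 * P * (1 + θ + θ ^ 2) * (B + derivBound K B) / s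
      + P * (1 + θ) * (∫ x, u.g x ^ 2 ∂unitVol + ∫ x, u.f x ^ 2 ∂unitVol) := by
  have s0 : 0 < s := by linarith
  have P0 : 0 ≤ P := by
    have := hA.trans hAP
    exact nonneg_of_mul_nonneg_left this (Real.exp_pos _)
  have hB0 := hB.nonneg
  have hexp := ACDeriv.exp_affine (-θ) 0
  simp only [add_zero] at hexp
  have hq := (ACDeriv.const A).add (hexp.const_mul (-P))
  have hT := (hq.mul (hu.acDeriv_energy hs ha.acDeriv hr.acDeriv)).add
    ((hexp.mul (hu.acDeriv_prodDeriv hs)).const_mul (θ * P / s ^ 2))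
  have h0 := hT.integral_eq le_rfl zero_le_one le_rfl
  have hdi := hu.integrable_dom (P * Real.exp (-θ) - P * (θ + θ ^ 2) / s)
    (-(P * (1 + θ ^ 2) / s ^ 3)) (-(P * (1 + θ)))
  have h1 := integral_mono_ae hdi hT.integrable (by
    filter_upwards [ae_restrict_mem measurableSet_Ioo, ha.deriv_le, hr.deriv_le] with x hx da dr
    have hx' := Ioo_subset_Icc_self hx
    have e1 : Real.exp (-θ * x) ≤ 1 := by rw [Real.exp_le_one_iff]; nlinarith [hx.1]
    have e2 : Real.exp (-θ) ≤ Real.exp (-θ * x) := by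
      rw [Real.exp_le_exp]; nlinarith [hx.2]
    exact flux_deriv_ge hs (ha.lower x hx') (hr.lower x hx') da dr hA hAP hθ hmθ
      (Real.exp_pos _) e2 e1)
  rw [h0, hu.integral_dom] at h1
  obtain ⟨⟨d1, d2⟩, -⟩ := hu.derivative_bounds hB hs hm ha hr
  have i1 : P * (θ + θ ^ 2) / s * (∫ x, u.v x ^ 2 ∂unitVol + ∫ x, u.N x ^ 2 ∂unitVol) ≤
      P * (1 + θ + θ ^ 2) / s * (B + B) := by
    gcongr
    · linarith
    · exact hB.v
    · exact hB.N
  have i2 : P * (1 + θ ^ 2) / s ^ 3 * (∫ x, u.v1 x ^ 2 ∂unitVol + ∫ x, u.N1 x ^ 2 ∂unitVol) ≤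
      P * (1 + θ + θ ^ 2) / s ^ 3 * (derivBound K B * s ^ 2 + derivBound K B * s ^ 2) := by
    gcongr
    linarith
  have i3 : P * (1 + θ + θ ^ 2) / s ^ 3 * (derivBound K B * s ^ 2 + derivBound K B * s ^ 2) =
      2 * P * (1 + θ + θ ^ 2) * derivBound K B / s := by field_simp; ring
  have i4 : P * (1 + θ + θ ^ 2) / s * (B + B) + 2 * P * (1 + θ + θ ^ 2) * derivBound K B / s =
      2 * P * (1 + θ + θ ^ 2) * (B + derivBound K B) / s := by ring
  have f1 : ∀ t, u.flux a r s A P θ t = (A + -P * Real.exp (-θ * t)) * u.energy a r s t +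
      θ * P / s ^ 2 * (Real.exp (-θ * t) * u.prodDeriv t) := by
    intro t; unfold flux; ring
  rw [f1, f1]
  linarith

end BeamState

/-! ### Boundedness of the traces at a junction. -/

namespace BeamState

/-- No boundary layer can be concentrated at a junction with bounded jumps. -/
theorem exists_junction_bound {m : ℝ} (hm : 0 < m) (hm1 : m ≤ 1) (K B : ℝ) {h h' : ℝ} (hh : 0 < h)
    (hh' : 0 < h') : ∃ C, 0 ≤ C ∧
    ∀ (u u' : BeamState) (a a₁ r r₁ a' a₁' r' r₁' : ℝ → ℝ) (s : ℝ), u.IsMode a r s →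
      u'.IsMode a' r' s → u.IsBounded B → u'.IsBounded B → 1 ≤ s →
      IsCoef m K a a₁ → IsCoef m K r r₁ → IsCoef m K a' a₁' → IsCoef m K r' r₁' →
      |u.v 1 - u'.v 0| ≤ 1 → |u.N 1 - u'.N 0| ≤ 1 → |u.v1 1 / h - u'.v1 0 / h'| ≤ 1 →
      |u.N1 1 / h - u'.N1 0 / h'| ≤ 1 →
      u.v 1 ^ 2 + u.N 1 ^ 2 ≤ C ∧ u.v1 1 ^ 2 + u.N1 1 ^ 2 ≤ C * s ^ 2 := by
  obtain ⟨T, T0, hT⟩ := IsMode.exists_trace_bound hm K B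
  obtain ⟨Λ, Λ0, hΛ⟩ := IsMode.exists_layer_bound hm hm1 K B
  -- The constants are dictated by `main'`, αw ≤ η + γY, where w is the product vN at the junction
  -- and Y the sum of the four scaled traces. As Y² ≤ 8(T + 1)(1 + w), Young's inequality absorbs γY
  -- into αw/2, and `W` is the bound on w that remains.
  set α := 2 * m * (1 / h + 1 / h') with hα
  set γ := 2 * m / h' + 1 / h + 1 with hγ
  set η := Λ * (1 / h + 1 / h') + 2 * m / h' + 2 with hη
  set W := 2 * (η + α / 2 + 4 * γ ^ 2 * (T + 1) / α) / α with hW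
  have α0 : 0 < α := by positivity
  have γ0 : 0 < γ := by positivity
  have η0 : 0 < η := by positivity
  have W0 : 0 ≤ W := by positivity
  refine ⟨T * (1 + W), by positivity, ?_⟩
  intro u u' a a₁ r r₁ a' a₁' r' r₁' s hu hu' hB hB' hs ha hr ha' hr' jv jN jv1 jN1
  have s0 : 0 < s := by linarith
  obtain ⟨t1, t2⟩ := hT u a a₁ r r₁ s hu hB hs ha hr 1 (by simp)
  suffices hw : max (u.v 1 * u.N 1) 0 ≤ W by
    refine ⟨t1.trans (by gcongr), t2.trans (by gcongr)⟩
  refine max_le ?_ W0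
  rcases le_or_gt (u.v 1 * u.N 1) 0 with hneg | hpos
  · exact hneg.trans W0
  rw [max_eq_left hpos.le] at t1 t2
  set w := u.v 1 * u.N 1
  obtain ⟨l1, -⟩ := hΛ u a a₁ r r₁ s hu hB hs ha hr
  obtain ⟨-, l2⟩ := hΛ u' a' a₁' r' r₁' s hu' hB' hs ha' hr'
  set p := |u.v1 1| / s with hp
  set q := |u.N1 1| / s with hq
  have p2 : p ^ 2 + q ^ 2 ≤ T * (1 + w) := by
    rw [hp, hq, div_pow, div_pow, sq_abs, sq_abs, ← add_div, div_le_iff₀ (by positivity)]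
    exact t2
  set Y := |u.v 1| + |u.N 1| + p + q with hY
  have Y2 : Y ^ 2 ≤ 8 * (T + 1) * (1 + w) := by
    have e1 : |u.v 1| ^ 2 + |u.N 1| ^ 2 ≤ T * (1 + w) := by rwa [sq_abs, sq_abs]
    nlinarith [sq_nonneg (|u.v 1| - |u.N 1|), sq_nonneg (|u.v 1| - p), sq_nonneg (|u.v 1| - q),
      sq_nonneg (|u.N 1| - p), sq_nonneg (|u.N 1| - q), sq_nonneg (p - q)]
  have p0 : 0 ≤ p := by positivity
  have q0 : 0 ≤ q := by positivity
  have hv0 := abs_nonneg (u.v 1)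
  have hN0 := abs_nonneg (u.N 1)
  have prod_ge : ∀ x y x' y' : ℝ, |x - x'| ≤ 1 → |y - y'| ≤ 1 →
      x * y - |x| - |y| - 1 ≤ x' * y' := by
    intro x y x' y' hx hy
    have e : x' * y' = x * y - (x - x') * y - x * (y - y') + (x - x') * (y - y') := by ring
    have e1 : |(x - x') * y| ≤ 1 * |y| := by rw [abs_mul]; gcongr
    have e2 : |x * (y - y')| ≤ |x| * 1 := by rw [abs_mul]; gcongr
    have e3 : |(x - x') * (y - y')| ≤ 1 * 1 := by rw [abs_mul]; gcongr
    rw [_root_.abs_le] at e1 e2 e3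
    linarith
  have g1 : w - |u.v 1| - |u.N 1| - 1 ≤ u'.v 0 * u'.N 0 := prod_ge _ _ _ _ jv jN
  have g2 := prod_ge _ _ _ _ jv1 jN
  have g3 := prod_ge _ _ _ _ jv jN1
  have g4 : |u.v1 1 / h| = s * (p / h) := by
    rw [abs_div, abs_of_pos hh, hp]; field_simp
  have g5 : |u.N1 1 / h| = s * (q / h) := by
    rw [abs_div, abs_of_pos hh, hq]; field_simp
  have l1' : (2 * m * s * w - Λ * s) / h ≤ u.prodDeriv 1 / h := by gcongr
  have l2' : u'.prodDeriv 0 / h' ≤ (-(2 * m * s * (u'.v 0 * u'.N 0)) + Λ * s) / h' := by gcongr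
  have l3 : (-(2 * m * s * (u'.v 0 * u'.N 0)) + Λ * s) / h' ≤
      (-(2 * m * s * (w - |u.v 1| - |u.N 1| - 1)) + Λ * s) / h' := by gcongr
  have g6 : u.prodDeriv 1 / h = u.v1 1 / h * u.N 1 + u.v 1 * (u.N1 1 / h) := by
    unfold prodDeriv; ring
  have g7 : u'.prodDeriv 0 / h' = u'.v1 0 / h' * u'.N 0 + u'.v 0 * (u'.N1 0 / h') := by
    unfold prodDeriv; ring
  -- Up to errors O(s(1 + Y)), (vN)'/h is at least 2msw/h on the left of the junction and at most
  -- -2msw/h' on the right, while the bounded jumps let the two differ only by O(s(1 + Y)).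
  have main : s * (α * w) ≤ s * (η + γ * Y) := by
    have z1 : (2 * m * s * w - Λ * s) / h = s * ((2 * m * w - Λ) * (1 / h)) := by ring
    have z2 : (-(2 * m * s * (w - |u.v 1| - |u.N 1| - 1)) + Λ * s) / h' =
      s * ((-(2 * m * (w - |u.v 1| - |u.N 1| - 1)) + Λ) * (1 / h')) := by ring
    have z3 : |u.v 1| + |u.N 1| ≤ s * (|u.v 1| + |u.N 1|) :=
      le_mul_of_one_le_left (by positivity) hs
    have z4 : s * (γ * Y) = s * (2 * m / h' * (|u.v 1| + |u.N 1|)) + s * (2 * m / h' * (p + q))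
      + s * (1 / h * (|u.v 1| + |u.N 1|)) + s * (p / h) + s * (q / h)
      + s * (|u.v 1| + |u.N 1|) + s * (p + q) := by rw [hγ, hY]; ring
    have z5 : 0 ≤ s * (2 * m / h' * (p + q)) := by positivity
    have z6 : 0 ≤ s * (1 / h * (|u.v 1| + |u.N 1|)) := by positivity
    have z7 : 0 ≤ s * (p + q) := by positivity
    have z8 : s * (α * w) = s * (2 * m * w * (1 / h)) + s * (2 * m * w * (1 / h')) := by
      rw [hα]; ring
    have z9 : s * η = s * (Λ * (1 / h)) + s * (Λ * (1 / h')) + s * (2 * m / h') + 2 * s := by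
      rw [hη]; ring
    have za : s * (2 * m / h' * (|u.v 1| + |u.N 1|)) =
      s * (2 * m * (|u.v 1| + |u.N 1|) * (1 / h')) := by ring
    have zb : s * (2 * m / h') = s * (2 * m * (1 / h')) := by ring
    rw [g4] at g2
    rw [g5] at g3
    rw [z1] at l1'
    rw [z2] at l3
    rw [mul_add, z8, z4, z9, za, zb]
    linarith
  have main' : α * w ≤ η + γ * Y := le_of_mul_le_mul_left main s0
  have young : γ * Y ≤ α / 2 * (1 + w) + 4 * γ ^ 2 * (T + 1) / α := by
    have e1 : γ * Y ≤ α / (16 * (T + 1)) * Y ^ 2 + 4 * γ ^ 2 * (T + 1) / α := by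
      have : α / (16 * (T + 1)) * Y ^ 2 + 4 * γ ^ 2 * (T + 1) / α - γ * Y =
        (α * Y - 8 * γ * (T + 1)) ^ 2 / (16 * (T + 1) * α) := by field_simp; ring
      have : 0 ≤ (α * Y - 8 * γ * (T + 1)) ^ 2 / (16 * (T + 1) * α) := by positivity
      linarith
    have e2 : α / (16 * (T + 1)) * Y ^ 2 ≤ α / (16 * (T + 1)) * (8 * (T + 1) * (1 + w)) := by gcongr
    have e3 : α / (16 * (T + 1)) * (8 * (T + 1) * (1 + w)) = α / 2 * (1 + w) := by field_simp; ring
    linarith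
  rw [hW, le_div_iff₀ α0]
  linarith

end BeamState

/-! ### Sequences of states on a chain and summation of the fluxes. -/

-- Boundedness on one side of the junction suffices: xy - x'y' consists of jumps times x or y and a
-- product of two jumps.
open Asymptotics in
theorem tendsto_mul_sub_mul {x y x' y' : ℕ → ℝ} (hx : x =O[atTop] fun _ => (1 : ℝ))
    (hy : y =O[atTop] fun _ => (1 : ℝ)) (hxx : Tendsto (fun i => x i - x' i) atTop (𝓝 0))
    (hyy : Tendsto (fun i => y i - y' i) atTop (𝓝 0)) :
    Tendsto (fun i => x i * y i - x' i * y' i) atTop (𝓝 0) := by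
  have h1 := ((isLittleO_one_iff ℝ).2 hxx).mul_isBigO hy
  have h2 := hx.mul_isLittleO ((isLittleO_one_iff ℝ).2 hyy)
  simp only [mul_one] at h1 h2
  have h3 := ((isLittleO_one_iff ℝ).1 (h1.add h2)).sub (hxx.mul hyy)
  simp only [mul_zero, sub_zero] at h3
  refine h3.congr fun i => ?_
  ring

/-- The reason why observing one factor of each product is enough at the ends of the chain: the
other factor is o(s²) in any case. -/
theorem tendsto_mul_div_of_or {x y s : ℕ → ℝ} (hx : Tendsto (fun i => x i / s i ^ 2) atTop (𝓝 0))
    (hy : Tendsto (fun i => y i / s i ^ 2) atTop (𝓝 0))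
    (h : Tendsto x atTop (𝓝 0) ∨ Tendsto y atTop (𝓝 0)) :
    Tendsto (fun i => x i * y i / s i ^ 2) atTop (𝓝 0) := by
  rcases h with h | h
  · have := h.mul hy
    simp only [mul_zero] at this
    exact this.congr fun i => by ring
  · have := hx.mul h
    simp only [mul_zero] at this
    exact this.congr fun i => by ring

open Asymptotics in
theorem isBigO_one_of_sq_le {x : ℕ → ℝ} {C : ℝ} (h : ∀ᶠ i in atTop, x i ^ 2 ≤ C) :
    x =O[atTop] fun _ => (1 : ℝ) := by
  refine IsBigO.of_bound √C ?_
  filter_upwards [h] with i hi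
  simpa using Real.abs_le_sqrt hi

theorem tendsto_div_sq {x s : ℕ → ℝ} {C : ℝ} (hs : Tendsto s atTop atTop)
    (h : ∀ᶠ i in atTop, x i ^ 2 ≤ C * s i ^ 3) :
    Tendsto (fun i => x i / s i ^ 2) atTop (𝓝 0) := by
  have h1 : Tendsto (fun i => C / s i) atTop (𝓝 0) := hs.const_div_atTop C
  have h2 : Tendsto (fun i => (x i / s i ^ 2) ^ 2) atTop (𝓝 0) := by
    refine squeeze_zero' (Eventually.of_forall fun i => sq_nonneg _) ?_ h1
    filter_upwards [h, hs.eventually_ge_atTop 1] with i hi si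
    have : 0 < s i := by linarith
    rw [div_pow, div_le_div_iff₀ (by positivity) this]
    calc x i ^ 2 * s i ≤ C * s i ^ 3 * s i := by gcongr
      _ = C * (s i ^ 2) ^ 2 := by ring
  have h3 := h2.sqrt
  simp only [Real.sqrt_sq_eq_abs, Real.sqrt_zero] at h3
  exact (tendsto_zero_iff_abs_tendsto_zero _).2 h3

/-- The length of the `j`-th interval of a partition. -/
def stepLen {n : ℕ} (z : Fin (n + 2) → ℝ) (j : Fin (n + 1)) : ℝ := z j.succ - z j.castSucc

/-- A sequence of states on a chain of beams with asymptotically vanishing right hand sides, jumps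
and observed boundary values. -/
structure IsApproxChain {n : ℕ} (z : Fin (n + 2) → ℝ) (a a' r r' : Fin (n + 1) → ℝ → ℝ)
    (m K B : ℝ) (s : ℕ → ℝ) (u : ℕ → Fin (n + 1) → BeamState) : Prop where
  mono : StrictMono z
  pos : 0 < m
  le_one : m ≤ 1
  coefA : ∀ j, IsCoef m K (a j) (a' j)
  coefR : ∀ j, IsCoef m K (r j) (r' j)
  jumpA : ∀ k : Fin n,
    a k.succ 0 / stepLen z k.succ ^ 2 ≤ a k.castSucc 1 / stepLen z k.castSucc ^ 2
  jumpR : ∀ k : Fin n,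
    r k.succ 0 / stepLen z k.succ ^ 2 ≤ r k.castSucc 1 / stepLen z k.castSucc ^ 2
  freq : Tendsto s atTop atTop
  mode : ∀ i j, (u i j).IsMode (a j) (r j) (s i)
  bounded : ∀ᶠ i in atTop, ∀ j, (u i j).IsBounded B
  rhs : ∀ j, Tendsto (fun i => ∫ x, (u i j).g x ^ 2 ∂unitVol + ∫ x, (u i j).f x ^ 2 ∂unitVol)
    atTop (𝓝 0)
  jumpV : ∀ k : Fin n, Tendsto (fun i => (u i k.castSucc).v 1 - (u i k.succ).v 0) atTop (𝓝 0)
  jumpN : ∀ k : Fin n, Tendsto (fun i => (u i k.castSucc).N 1 - (u i k.succ).N 0) atTop (𝓝 0)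
  jumpV1 : ∀ k : Fin n, Tendsto (fun i => (u i k.castSucc).v1 1 / stepLen z k.castSucc
    - (u i k.succ).v1 0 / stepLen z k.succ) atTop (𝓝 0)
  jumpN1 : ∀ k : Fin n, Tendsto (fun i => (u i k.castSucc).N1 1 / stepLen z k.castSucc
    - (u i k.succ).N1 0 / stepLen z k.succ) atTop (𝓝 0)
  leftV : Tendsto (fun i => (u i 0).v 0) atTop (𝓝 0)
  leftN : Tendsto (fun i => (u i 0).N 0) atTop (𝓝 0)
  left : Tendsto (fun i => (u i 0).v1 0) atTop (𝓝 0) ∨ Tendsto (fun i => (u i 0).N1 0) atTop (𝓝 0)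
  right : Tendsto (fun i => (u i (Fin.last n)).v 1) atTop (𝓝 0) ∨
    Tendsto (fun i => (u i (Fin.last n)).N1 1) atTop (𝓝 0)
  right' : Tendsto (fun i => (u i (Fin.last n)).v1 1) atTop (𝓝 0) ∨
    Tendsto (fun i => (u i (Fin.last n)).N 1) atTop (𝓝 0)

namespace IsApproxChain

variable {n : ℕ} {z : Fin (n + 2) → ℝ} {a a' r r' : Fin (n + 1) → ℝ → ℝ} {m K B : ℝ} {s : ℕ → ℝ}
  {u : ℕ → Fin (n + 1) → BeamState}

theorem stepLen_pos (h : IsApproxChain z a a' r r' m K B s u) (j : Fin (n + 1)) :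
    0 < stepLen z j :=
  sub_pos.2 (h.mono j.castSucc_lt_succ)

/-- Squared traces are O(s³). This crude bound serves the two ends of the chain but not the
junctions. -/
theorem tendsto_trace (h : IsApproxChain z a a' r r' m K B s u) (j : Fin (n + 1)) {t : ℝ}
    (ht : t ∈ Icc (0 : ℝ) 1) :
    (Tendsto (fun i => (u i j).v t / s i ^ 2) atTop (𝓝 0) ∧
      Tendsto (fun i => (u i j).N t / s i ^ 2) atTop (𝓝 0)) ∧
    Tendsto (fun i => (u i j).v1 t / s i ^ 2) atTop (𝓝 0) ∧
      Tendsto (fun i => (u i j).N1 t / s i ^ 2) atTop (𝓝 0) := by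
  have key : ∀ᶠ i in atTop, ((u i j).v t ^ 2 ≤ BeamState.derivBound K B * s i ^ 3 ∧
      (u i j).N t ^ 2 ≤ BeamState.derivBound K B * s i ^ 3) ∧
      (u i j).v1 t ^ 2 ≤ BeamState.derivBound K B * s i ^ 3 ∧
      (u i j).N1 t ^ 2 ≤ BeamState.derivBound K B * s i ^ 3 := by
    filter_upwards [h.bounded, h.freq.eventually_ge_atTop 1] with i hB hs
    obtain ⟨-, h2⟩ := (h.mode i j).derivative_bounds (hB j) hs h.pos (h.coefA j) (h.coefR j)
    obtain ⟨⟨b1, b2⟩, b3⟩ := h2 t ht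
    have hD : 0 ≤ BeamState.derivBound K B := by
      have := (hB j).nonneg
      unfold BeamState.derivBound; positivity
    have hs3 : BeamState.derivBound K B * s i ≤ BeamState.derivBound K B * s i ^ 3 := by
      gcongr
      exact le_self_pow₀ hs (by norm_num)
    exact ⟨⟨b1.trans hs3, b2.trans hs3⟩, b3⟩
  exact ⟨⟨tendsto_div_sq h.freq (key.mono fun _ hi => hi.1.1),
    tendsto_div_sq h.freq (key.mono fun _ hi => hi.1.2)⟩,
    tendsto_div_sq h.freq (key.mono fun _ hi => hi.2.1),
    tendsto_div_sq h.freq (key.mono fun _ hi => hi.2.2)⟩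

-- The jumps of v and N are merely o(1) and get multiplied by v and N themselves, so the crude
-- growth s^(1/2) has to be improved to boundedness.
open Asymptotics in
theorem isBigO_junction (h : IsApproxChain z a a' r r' m K B s u) (k : Fin n) :
    (((fun i => (u i k.castSucc).v 1) =O[atTop] fun _ => (1 : ℝ)) ∧
      (fun i => (u i k.castSucc).N 1) =O[atTop] fun _ => (1 : ℝ)) ∧
    ((fun i => (u i k.castSucc).v1 1 / stepLen z k.castSucc / s i) =O[atTop] fun _ => (1 : ℝ)) ∧
      (fun i => (u i k.castSucc).N1 1 / stepLen z k.castSucc / s i) =O[atTop]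
        fun _ => (1 : ℝ) := by
  obtain ⟨C, -, hC⟩ := BeamState.exists_junction_bound h.pos h.le_one K B
    (h.stepLen_pos k.castSucc) (h.stepLen_pos k.succ)
  have one : ∀ {x : ℕ → ℝ}, Tendsto x atTop (𝓝 0) → ∀ᶠ i in atTop, |x i| ≤ 1 := fun hx =>
    (hx.abs.eventually (ge_mem_nhds (by simp))).mono fun i hi => hi
  have key : ∀ᶠ i in atTop, (u i k.castSucc).v 1 ^ 2 + (u i k.castSucc).N 1 ^ 2 ≤ C ∧
      (u i k.castSucc).v1 1 ^ 2 + (u i k.castSucc).N1 1 ^ 2 ≤ C * s i ^ 2 ∧ 1 ≤ s i := by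
    filter_upwards [h.bounded, h.freq.eventually_ge_atTop 1, one (h.jumpV k), one (h.jumpN k),
      one (h.jumpV1 k), one (h.jumpN1 k)] with i hB hs j1 j2 j3 j4
    have := hC _ _ _ _ _ _ _ _ _ _ _ (h.mode i k.castSucc) (h.mode i k.succ) (hB _) (hB _) hs
      (h.coefA _) (h.coefR _) (h.coefA _) (h.coefR _) j1 j2 j3 j4
    exact ⟨this.1, this.2, hs⟩
  have hl := h.stepLen_pos k.castSucc
  have div_le : ∀ x t : ℝ, 1 ≤ t → x ^ 2 ≤ C * t ^ 2 →
      (x / stepLen z k.castSucc / t) ^ 2 ≤ C / stepLen z k.castSucc ^ 2 := by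
    intro x t ht hx
    have t0 : 0 < t := by linarith
    rw [div_div, div_pow, div_le_div_iff₀ (by positivity) (by positivity)]
    calc x ^ 2 * stepLen z k.castSucc ^ 2 ≤ C * t ^ 2 * stepLen z k.castSucc ^ 2 := by gcongr
      _ = _ := by ring
  refine ⟨⟨isBigO_one_of_sq_le (C := C) ?_, isBigO_one_of_sq_le (C := C) ?_⟩,
    isBigO_one_of_sq_le (C := C / stepLen z k.castSucc ^ 2) ?_,
    isBigO_one_of_sq_le (C := C / stepLen z k.castSucc ^ 2) ?_⟩
  · filter_upwards [key] with i hi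
    linarith [sq_nonneg ((u i k.castSucc).N 1), hi.1]
  · filter_upwards [key] with i hi
    linarith [sq_nonneg ((u i k.castSucc).v 1), hi.1]
  · filter_upwards [key] with i hi
    exact div_le _ _ hi.2.2 (by linarith [sq_nonneg ((u i k.castSucc).N1 1), hi.2.1])
  · filter_upwards [key] with i hi
    exact div_le _ _ hi.2.2 (by linarith [sq_nonneg ((u i k.castSucc).v1 1), hi.2.1])

/-- The scaled boundary functional of beam `j` for the weight `exp(-κ L) - exp(-κ z)`. -/
noncomputable def beamFlux (z : Fin (n + 2) → ℝ) (a r : Fin (n + 1) → ℝ → ℝ) (s : ℕ → ℝ)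
    (u : ℕ → Fin (n + 1) → BeamState) (κ : ℝ) (i : ℕ) (j : Fin (n + 1)) (t : ℝ) : ℝ :=
  (u i j).flux (a j) (r j) (s i) (Real.exp (-(κ * z (Fin.last (n + 1)))))
    (Real.exp (-(κ * z j.castSucc))) (κ * stepLen z j) t / stepLen z j ^ 2

/-- Makes the weight continuous at the nodes: the exponential at the end of one beam is the
amplitude on the next. -/
theorem exp_step (κ : ℝ) (j : Fin (n + 1)) :
    Real.exp (-(κ * z j.castSucc)) * Real.exp (-(κ * stepLen z j)) =
      Real.exp (-(κ * z j.succ)) := by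
  rw [← Real.exp_add]
  congr 1
  unfold stepLen
  ring

/-- The division by h² turns reference derivatives into physical ones, so apart from the
coefficients the flux changes only through vanishing jumps times bounded traces. The change of
coefficients is multiplied by the nonpositive weight Q and, by the jump condition, can be dropped.
-/
theorem exists_junction_flux (h : IsApproxChain z a a' r r' m K B s u) {κ : ℝ} (hκ : 0 ≤ κ)
    (k : Fin n) : ∃ R : ℕ → ℝ, Tendsto R atTop (𝓝 0) ∧
      ∀ᶠ i in atTop, beamFlux z a r s u κ i k.castSucc 1 - beamFlux z a r s u κ i k.succ 0 ≤ R i := by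
  obtain ⟨⟨bv, bN⟩, bp, bq⟩ := h.isBigO_junction k
  have sinv : Tendsto (fun i => (s i)⁻¹) atTop (𝓝 0) := h.freq.inv_tendsto_atTop
  have jp : Tendsto (fun i => (u i k.castSucc).v1 1 / stepLen z k.castSucc / s i
      - (u i k.succ).v1 0 / stepLen z k.succ / s i) atTop (𝓝 0) := by
    have := (h.jumpV1 k).mul sinv
    simp only [mul_zero] at this
    exact this.congr fun i => by ring
  have jq : Tendsto (fun i => (u i k.castSucc).N1 1 / stepLen z k.castSucc / s i
      - (u i k.succ).N1 0 / stepLen z k.succ / s i) atTop (𝓝 0) := by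
    have := (h.jumpN1 k).mul sinv
    simp only [mul_zero] at this
    exact this.congr fun i => by ring
  have d1 := tendsto_mul_sub_mul bN bN (h.jumpN k) (h.jumpN k)
  have d2 := tendsto_mul_sub_mul bv bv (h.jumpV k) (h.jumpV k)
  have d3 := tendsto_mul_sub_mul bp bq jp jq
  have d4 := (tendsto_mul_sub_mul bp bN jp (h.jumpN k)).mul sinv
  have d5 := (tendsto_mul_sub_mul bv bq (h.jumpV k) jq).mul sinv
  set hl := stepLen z k.castSucc with hhl
  set hr := stepLen z k.succ with hhr
  have hl0 : 0 < hl := h.stepLen_pos _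
  have hr0 : 0 < hr := h.stepLen_pos _
  set e := Real.exp (-(κ * z k.succ.castSucc)) with he
  set Q := Real.exp (-(κ * z (Fin.last (n + 1)))) - e with hQ
  have Q0 : Q ≤ 0 := by
    rw [hQ, sub_nonpos, he, Real.exp_le_exp, neg_le_neg_iff]
    gcongr
    exact h.mono.monotone (Fin.le_last _)
  have lim := ((((d1.const_mul (a k.succ 0 / hr ^ 2)).add
    (d2.const_mul (r k.succ 0 / hr ^ 2))).sub (d3.const_mul 2)).const_mul Q).add
    ((d4.add d5).const_mul (κ * e))
  simp only [mul_zero, add_zero, sub_zero] at lim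
  refine ⟨_, lim, ?_⟩
  filter_upwards [h.freq.eventually_ge_atTop 1] with i hs
  have s0 : 0 < s i := by linarith
  have hstep := exp_step (z := z) κ k.castSucc
  rw [Fin.succ_castSucc, ← he, ← hhl] at hstep
  have q1 : Q * ((a k.castSucc 1 / hl ^ 2 - a k.succ 0 / hr ^ 2) * (u i k.castSucc).N 1 ^ 2
      + (r k.castSucc 1 / hl ^ 2 - r k.succ 0 / hr ^ 2) * (u i k.castSucc).v 1 ^ 2) ≤ 0 := by
    have j1 := sub_nonneg.2 (h.jumpA k)
    have j2 := sub_nonneg.2 (h.jumpR k)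
    exact mul_nonpos_of_nonpos_of_nonneg Q0 (by positivity)
  unfold beamFlux BeamState.flux
  rw [← hhl, ← hhr, ← he]
  simp only [mul_one, mul_zero, Real.exp_zero]
  rw [mul_assoc (κ * hl), hstep, ← hQ]
  unfold BeamState.energy BeamState.prodDeriv
  refine le_of_sub_nonneg ((neg_nonneg.2 q1).trans (le_of_eq ?_))
  field_simp
  ring

/-- The weight does not vanish at this end, so the full energy enters and v'N'/s² requires a third
vanishing trace. -/
theorem tendsto_left_flux (h : IsApproxChain z a a' r r' m K B s u) (κ : ℝ) :
    Tendsto (fun i => beamFlux z a r s u κ i 0 0) atTop (𝓝 0) := by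
  obtain ⟨⟨t1, t2⟩, t3, t4⟩ := h.tendsto_trace 0 (t := 0) (by simp)
  have d1 := tendsto_mul_div_of_or t3 t4 h.left
  have d2 := tendsto_mul_div_of_or t3 t2 (.inr h.leftN)
  have d3 := tendsto_mul_div_of_or t1 t4 (.inl h.leftV)
  have e := (((((h.leftN.mul h.leftN).const_mul (a 0 0)).add
    ((h.leftV.mul h.leftV).const_mul (r 0 0))).sub (d1.const_mul 2)).const_mul
    ((Real.exp (-(κ * z (Fin.last (n + 1)))) - Real.exp (-(κ * z (0 : Fin (n + 1)).castSucc)))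
      / stepLen z 0 ^ 2)).add ((d2.add d3).const_mul
      (κ * stepLen z 0 * Real.exp (-(κ * z (0 : Fin (n + 1)).castSucc)) / stepLen z 0 ^ 2))
  simp only [mul_zero, add_zero, sub_zero] at e
  refine e.congr fun i => ?_
  unfold beamFlux BeamState.flux BeamState.energy BeamState.prodDeriv
  simp only [mul_zero, Real.exp_zero]
  ring

/-- The weight is zero at this end, so the energy drops out and only (vN)'/s² has to be controlled.
-/
theorem tendsto_right_flux (h : IsApproxChain z a a' r r' m K B s u) (κ : ℝ) :
    Tendsto (fun i => beamFlux z a r s u κ i (Fin.last n) 1) atTop (𝓝 0) := by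
  obtain ⟨⟨t1, t2⟩, t3, t4⟩ := h.tendsto_trace (Fin.last n) (t := 1) (by simp)
  have d2 := tendsto_mul_div_of_or t3 t2 h.right'
  have d3 := tendsto_mul_div_of_or t1 t4 h.right
  have e := (d2.add d3).const_mul (κ * stepLen z (Fin.last n) *
    Real.exp (-(κ * z (Fin.last (n + 1)))) / stepLen z (Fin.last n) ^ 2)
  simp only [mul_zero, add_zero] at e
  refine e.congr fun i => ?_
  have hstep := exp_step (z := z) κ (Fin.last n)
  rw [Fin.succ_last] at hstep
  unfold beamFlux BeamState.flux BeamState.prodDeriv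
  simp only [mul_one]
  rw [mul_assoc (κ * stepLen z (Fin.last n)), hstep, sub_self]
  ring

theorem tendsto_integral (h : IsApproxChain z a a' r r' m K B s u) (j : Fin (n + 1)) :
    Tendsto (fun i => ∫ x, (u i j).v x ^ 2 ∂unitVol + ∫ x, (u i j).N x ^ 2 ∂unitVol)
      atTop (𝓝 0) := by
  -- A single rate that is large enough for every beam; summing the individual requirements avoids a
  -- maximum.
  set κ := ∑ j, (1 + |K|) / (2 * m * stepLen z j) with hκd
  have hm := h.pos
  have κterm : ∀ j, 0 ≤ (1 + |K|) / (2 * m * stepLen z j) := fun j => by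
    have := h.stepLen_pos j
    positivity
  have κ0 : 0 ≤ κ := Finset.sum_nonneg fun j _ => κterm j
  have hκ : ∀ j, 1 ≤ 2 * (κ * stepLen z j) * m - K := by
    intro j
    have h1 : (1 + |K|) / (2 * m * stepLen z j) ≤ κ :=
      Finset.single_le_sum (f := fun j => (1 + |K|) / (2 * m * stepLen z j))
        (fun j _ => κterm j) (Finset.mem_univ j)
    have := h.stepLen_pos j
    rw [div_le_iff₀ (by positivity)] at h1
    linarith [le_abs_self K]
  choose R hR0 hR using fun k => h.exists_junction_flux κ0 k
  set P : Fin (n + 1) → ℝ := fun j => Real.exp (-(κ * z j.castSucc)) with hP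
  set θ : Fin (n + 1) → ℝ := fun j => κ * stepLen z j with hθ
  set I : ℕ → Fin (n + 1) → ℝ := fun i j =>
    ∫ x, (u i j).v x ^ 2 ∂unitVol + ∫ x, (u i j).N x ^ 2 ∂unitVol with hI
  set G : ℕ → Fin (n + 1) → ℝ := fun i j =>
    ∫ x, (u i j).g x ^ 2 ∂unitVol + ∫ x, (u i j).f x ^ 2 ∂unitVol with hG
  set w : Fin (n + 1) → ℝ := fun j => P j * Real.exp (-θ j) / stepLen z j ^ 2 with hw
  have w0 : ∀ j, 0 < w j := fun j => by
    have := h.stepLen_pos j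
    simp only [hw, hP]
    positivity
  have I0 : ∀ i j, 0 ≤ I i j := fun i j => add_nonneg (integral_nonneg fun _ => sq_nonneg _)
    (integral_nonneg fun _ => sq_nonneg _)
  set E : ℕ → Fin (n + 1) → ℝ := fun i j =>
    (2 * P j * (1 + θ j + θ j ^ 2) * (B + BeamState.derivBound K B) / s i
      + P j * (1 + θ j) * G i j) / stepLen z j ^ 2 with hE
  have E0 : ∀ j, Tendsto (fun i => E i j) atTop (𝓝 0) := by
    intro j
    have e1 : Tendsto (fun i => 2 * P j * (1 + θ j + θ j ^ 2) * (B + BeamState.derivBound K B)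
      / s i) atTop (𝓝 0) := h.freq.const_div_atTop _
    have e2 := (h.rhs j).const_mul (P j * (1 + θ j))
    simpa using (e1.add e2).div_const (stepLen z j ^ 2)
  have beam : ∀ᶠ i in atTop, ∀ j, w j * I i j ≤
      beamFlux z a r s u κ i j 1 - beamFlux z a r s u κ i j 0 + E i j := by
    filter_upwards [h.bounded, h.freq.eventually_ge_atTop 1] with i hB hs j
    have hl := h.stepLen_pos j
    have hf := (h.mode i j).flux_bound (hB j) hs hm (h.coefA j) (h.coefR j)
      (A := Real.exp (-(κ * z (Fin.last (n + 1))))) (P := P j) (θ := θ j) (Real.exp_pos _).le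
      (by
        simp only [hP, hθ, exp_step]
        rw [Real.exp_le_exp, neg_le_neg_iff]
        gcongr
        exact h.mono.monotone (Fin.le_last _)) (mul_nonneg κ0 hl.le) (hκ j)
    have hf' := div_le_div_of_nonneg_right hf (sq_nonneg (stepLen z j))
    refine le_trans (le_of_eq ?_) (hf'.trans (le_of_eq ?_))
    · simp only [hw, hI]; ring
    · simp only [hE, hG, beamFlux, hP, hθ]; ring
  have total : ∀ᶠ i in atTop, w j * I i j ≤ beamFlux z a r s u κ i (Fin.last n) 1
      - beamFlux z a r s u κ i 0 0 + ∑ k, R k i + ∑ j, E i j := by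
    filter_upwards [beam, eventually_all.2 hR] with i hi hRi
    have h1 : w j * I i j ≤ ∑ j, w j * I i j :=
      Finset.single_le_sum (f := fun j => w j * I i j)
        (fun j _ => mul_nonneg (w0 j).le (I0 i j)) (Finset.mem_univ j)
    have h2 := Finset.sum_le_sum fun j (_ : j ∈ Finset.univ) => hi j
    -- Detaching the last right-end flux and the first left-end flux pairs the remaining ones
    -- junction by junction.
    rw [Finset.sum_add_distrib, Finset.sum_sub_distrib,
      Fin.sum_univ_castSucc (fun j => beamFlux z a r s u κ i j 1),
      Fin.sum_univ_succ (fun j => beamFlux z a r s u κ i j 0)] at h2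
    have h3 := Finset.sum_le_sum fun k (_ : k ∈ Finset.univ) => hRi k
    rw [Finset.sum_sub_distrib] at h3
    linarith
  have lim : Tendsto (fun i => (beamFlux z a r s u κ i (Fin.last n) 1
      - beamFlux z a r s u κ i 0 0 + ∑ k, R k i + ∑ j, E i j) / w j) atTop (𝓝 0) := by
    have l1 : Tendsto (fun i => ∑ k, R k i) atTop (𝓝 0) := by
      simpa using tendsto_finsetSum Finset.univ fun k _ => hR0 k
    have l2 : Tendsto (fun i => ∑ j, E i j) atTop (𝓝 0) := by
      simpa using tendsto_finsetSum Finset.univ fun j _ => E0 j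
    simpa using ((((h.tendsto_right_flux κ).sub (h.tendsto_left_flux κ)).add l1).add l2).div_const
      (w j)
  refine squeeze_zero' (Eventually.of_forall fun i => I0 i j) ?_ lim
  filter_upwards [total] with i hi
  rw [le_div_iff₀ (w0 j), mul_comm]
  exact hi

end IsApproxChain

/-! ### Lipschitz coefficients and Sobolev representatives. -/

/-- Lipschitz continuous and uniformly positive on `[0,1]`. -/
structure IsLipPos (f : ℝ → ℝ) : Prop where
  lip : ∃ K, LipschitzOnWith K f (Icc 0 1)
  pos : ∃ ε > 0, ∀ t ∈ Icc (0 : ℝ) 1, ε ≤ f t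

namespace IsLipPos

variable {f : ℝ → ℝ}

theorem inv (h : IsLipPos f) : IsLipPos fun t => (f t)⁻¹ := by
  obtain ⟨⟨K, hK⟩, ε, hε, hf⟩ := h
  have fpos : ∀ t ∈ Icc (0 : ℝ) 1, 0 < f t := fun t ht => hε.trans_le (hf t ht)
  constructor
  · refine ⟨(K / ε ^ 2).toNNReal, LipschitzOnWith.of_dist_le_mul fun x hx y hy => ?_⟩
    have h1 := hK.dist_le_mul x hx y hy
    have hx' := fpos x hx
    have hy' := fpos y hy
    rw [Real.coe_toNNReal _ (by positivity), Real.dist_eq, inv_sub_inv hx'.ne' hy'.ne', abs_div,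
      abs_of_pos (mul_pos hx' hy'), abs_sub_comm, ← Real.dist_eq (f x)]
    calc dist (f x) (f y) / (f x * f y) ≤ K * dist x y / (ε * ε) := by
          gcongr
          · exact hf x hx
          · exact hf y hy
      _ = K / ε ^ 2 * dist x y := by ring
  · obtain ⟨M, hM⟩ := isCompact_Icc.exists_bound_of_continuousOn hK.continuousOn
    have M0 : 0 < M := by
      have := hM 0 (by simp)
      exact (norm_pos_iff.2 (fpos 0 (by simp)).ne').trans_le this
    refine ⟨M⁻¹, by positivity, fun t ht => ?_⟩
    have h1 := fpos t ht
    gcongr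
    exact (le_abs_self _).trans (hM t ht)

theorem const_mul (h : IsLipPos f) {c : ℝ} (hc : 0 < c) : IsLipPos fun t => c * f t := by
  obtain ⟨⟨K, hK⟩, ε, hε, hf⟩ := h
  refine ⟨⟨c.toNNReal * K, LipschitzOnWith.of_dist_le_mul fun x hx y hy => ?_⟩, c * ε,
    by positivity, fun t ht => by gcongr; exact hf t ht⟩
  have h1 := hK.dist_le_mul x hx y hy
  rw [NNReal.coe_mul, Real.coe_toNNReal _ hc.le, Real.dist_eq, ← mul_sub, abs_mul, abs_of_pos hc,
    mul_assoc, ← Real.dist_eq]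
  gcongr

theorem comp_segment {p q : ℝ} (hpq : p ≤ q) {K : NNReal} (hK : LipschitzOnWith K f (Icc p q))
    {ε : ℝ} (hε : 0 < ε) (hf : ∀ x ∈ Icc p q, ε ≤ f x) :
    IsLipPos fun t => f ((1 - t) * p + t * q) := by
  have hmem : ∀ t ∈ Icc (0 : ℝ) 1, (1 - t) * p + t * q ∈ Icc p q := fun t ht =>
    ⟨by nlinarith [ht.1, ht.2], by nlinarith [ht.1, ht.2]⟩
  refine ⟨⟨K * (q - p).toNNReal, LipschitzOnWith.of_dist_le_mul fun x hx y hy => ?_⟩, ε, hε,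
    fun t ht => hf _ (hmem t ht)⟩
  have h1 := hK.dist_le_mul _ (hmem x hx) _ (hmem y hy)
  have e : (1 - x) * p + x * q - ((1 - y) * p + y * q) = (q - p) * (x - y) := by ring
  rw [Real.dist_eq ((1 - x) * p + x * q), e, abs_mul, abs_of_nonneg (sub_nonneg.2 hpq)] at h1
  rw [NNReal.coe_mul, Real.coe_toNNReal _ (sub_nonneg.2 hpq), Real.dist_eq x, mul_assoc]
  exact h1

/-- Allowing all weaker constants `m'`, `K'` lets finitely many coefficients share one pair in
`exists_uniform`. -/
theorem exists_isCoef (h : IsLipPos f) : ∃ m > 0, ∃ K : ℝ, ∀ m' K' : ℝ, m' ≤ m → K ≤ K' →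
    IsCoef m' K' f (deriv f) := by
  obtain ⟨⟨L, hL⟩, ε, hε, hf⟩ := h
  obtain ⟨M, hM⟩ := isCompact_Icc.exists_bound_of_continuousOn hL.continuousOn
  refine ⟨ε, hε, max L M, fun m' K' hm hK => ?_⟩
  have hac : AbsolutelyContinuousOnInterval f 0 1 :=
    LipschitzOnWith.absolutelyContinuousOnInterval (by rwa [uIcc_of_le zero_le_one])
  refine ⟨⟨hac, ?_⟩, fun t ht => hm.trans (hf t ht),
    fun t ht => (le_abs_self _).trans ((hM t ht).trans ((le_max_right _ _).trans hK)), ?_⟩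
  · rw [ae_restrict_iff' measurableSet_Ioo]
    filter_upwards [hac.ae_differentiableAt] with t ht htI
    refine (ht ?_).hasDerivAt
    rw [uIcc_of_le zero_le_one]
    exact Ioo_subset_Icc_self htI
  · filter_upwards [ae_restrict_mem measurableSet_Ioo] with t ht
    exact (norm_deriv_le_of_lipschitzOn (Icc_mem_nhds ht.1 ht.2) hL).trans
      ((le_max_left _ _).trans hK)

/-- Finitely many coefficients have common bounds. -/
theorem exists_uniform {ι : Type*} [Finite ι] {F : ι → ℝ → ℝ} (h : ∀ p, IsLipPos (F p)) :
    ∃ m, 0 < m ∧ m ≤ 1 ∧ ∃ K, ∀ p, IsCoef m K (F p) (deriv (F p)) := by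
  choose m hm K hK using fun p => (h p).exists_isCoef
  obtain ⟨M, hM⟩ := Finite.exists_le (fun p => (m p)⁻¹)
  obtain ⟨L, hL⟩ := Finite.exists_le K
  refine ⟨(max M 1)⁻¹, by positivity, inv_le_one_of_one_le₀ (le_max_right _ _), L,
    fun p => hK p _ _ ?_ (hL p)⟩
  rw [inv_le_comm₀ (by positivity) (hm p)]
  exact (hM p).trans (le_max_left _ _)

end IsLipPos

theorem AbsolutelyContinuousOnInterval.congr_uIcc {f g : ℝ → ℝ} {p q : ℝ}
    (hf : AbsolutelyContinuousOnInterval f p q) (h : ∀ t ∈ uIcc p q, g t = f t) :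
    AbsolutelyContinuousOnInterval g p q := by
  rw [absolutelyContinuousOnInterval_iff] at hf ⊢
  intro ε hε
  obtain ⟨δ, hδ, hE⟩ := hf ε hε
  refine ⟨δ, hδ, fun E hEd hlen => ?_⟩
  have := hE E hEd hlen
  rwa [Finset.sum_congr rfl fun i hi => by
    rw [h _ (hEd.1 i hi).1, h _ (hEd.1 i hi).2]]

theorem IsSobolevPrimitive.acDeriv {u v : ℝ → ℂ} (h : IsSobolevPrimitive u v) (l : ℂ →L[ℝ] ℝ) :
    ACDeriv (fun t => l (u t)) (fun t => l (v t)) := by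
  have hi := h.intervalIntegrable
  have hl : IntervalIntegrable (fun t => l (v t)) volume 0 1 :=
    ⟨l.integrable_comp hi.1, l.integrable_comp hi.2⟩
  have heq : ∀ t ∈ Icc (0 : ℝ) 1, l (u t) = l (u 0) + ∫ s in (0 : ℝ)..t, l (v s) := by
    intro t ht
    have hs : uIcc 0 t ⊆ uIcc (0 : ℝ) 1 := by
      rw [uIcc_of_le ht.1, uIcc_of_le zero_le_one]
      exact Icc_subset_Icc_right ht.2
    rw [h.eq_integral t ht, map_add, l.intervalIntegral_comp_comm (hi.mono_set hs)]
  constructor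
  · have h1 := (ACDeriv.const (l (u 0))).ac.add
      (hl.absolutelyContinuousOnInterval_intervalIntegral left_mem_uIcc)
    refine h1.congr_uIcc fun t ht => ?_
    rw [uIcc_of_le zero_le_one] at ht
    exact heq t ht
  · rw [ae_restrict_iff' measurableSet_Ioo]
    filter_upwards [hl.ae_hasDerivAt_integral] with t ht htI
    have ht' := ht (by rw [uIcc_of_le zero_le_one]; exact Ioo_subset_Icc_self htI) 0 left_mem_uIcc
    refine (ht'.const_add (l (u 0))).congr_of_eventuallyEq ?_
    filter_upwards [Ioo_mem_nhds htI.1 htI.2] with x hx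
    exact heq x (Ioo_subset_Icc_self hx)

/-! ### From the complex resolvent equation to the real system. -/

namespace BeamChain

variable {n : ℕ} {c : BeamChain n}

theorem len_pos (c : BeamChain n) (j : Fin (n + 1)) : 0 < c.len j :=
  sub_pos.2 (c.node_strictMono j.castSucc_lt_succ)

theorem Regular.isLipPos_H (hR : c.Regular) (j : Fin (n + 1)) (i : Fin 2) :
    IsLipPos (c.H j i) := by
  obtain ⟨⟨K, hK⟩, ⟨K', hK'⟩, ε, hε, h⟩ := hR j
  have hle : c.node j.castSucc ≤ c.node j.succ := (c.node_strictMono j.castSucc_lt_succ).le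
  fin_cases i
  · exact (IsLipPos.comp_segment hle hK hε fun x hx => (h x hx).1).inv
  · exact IsLipPos.comp_segment hle hK' hε fun x hx => (h x hx).2

theorem memLp_coord (x : BeamSpace n) (j : Fin (n + 1)) (i : Fin 2) :
    MemLp (fun t => x t (j, i)) 2 unitVol :=
  (EuclideanSpace.proj (𝕜 := ℂ) (j, i) : EuclideanSpace ℂ (Fin (n + 1) × Fin 2) →L[ℂ] ℂ).comp_memLp'
    (Lp.memLp x)

theorem norm_sq_eq (x : BeamSpace n) :
    ‖x‖ ^ 2 = ∑ p, ∫ t, ‖x t p‖ ^ 2 ∂unitVol := by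
  rw [← integral_finsetSum _ fun p _ => (memLp_coord x p.1 p.2).integrable_norm_pow (by simp),
    ← inner_self_eq_norm_sq (𝕜 := ℂ), L2.inner_def, ← integral_re (L2.integrable_inner x x)]
  congr 1
  ext t
  rw [inner_self_eq_norm_sq, EuclideanSpace.norm_eq, Real.sq_sqrt (by positivity)]

theorem integral_norm_sq_le {m K : ℝ} {H' : Fin (n + 1) → Fin 2 → ℝ → ℝ} (hm : 0 < m)
    (hH : ∀ j i, IsCoef m K (c.H j i) (H' j i)) (x : BeamSpace n) (j : Fin (n + 1)) (i : Fin 2) :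
    ∫ t, ‖x t (j, i)‖ ^ 2 ∂unitVol ≤ c.energyNorm x ^ 2 / m := by
  have hx : ∀ j i, Integrable (fun t => ‖x t (j, i)‖ ^ 2) unitVol := fun j i =>
    (memLp_coord x j i).integrable_norm_pow (by simp)
  have hHx : ∀ j i, Integrable (fun t => c.H j i t * ‖x t (j, i)‖ ^ 2) unitVol := fun j i => by
    refine (hx j i).bdd_mul (c := K) (hH j i).acDeriv.integrable_self.aestronglyMeasurable ?_
    filter_upwards [ae_restrict_mem measurableSet_Ioo] with t ht
    have h1 := (hH j i).lower t (Ioo_subset_Icc_self ht)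
    rw [Real.norm_eq_abs, abs_of_nonneg (by linarith)]
    exact (hH j i).upper t (Ioo_subset_Icc_self ht)
  have nn : ∀ᵐ t ∂unitVol, ∀ j i, 0 ≤ c.H j i t * ‖x t (j, i)‖ ^ 2 := by
    filter_upwards [ae_restrict_mem measurableSet_Ioo] with t ht j i
    have h1 := (hH j i).lower t (Ioo_subset_Icc_self ht)
    exact mul_nonneg (by linarith) (sq_nonneg _)
  have he : c.energyNorm x ^ 2 = ∫ t, ∑ j, ∑ i, c.H j i t * ‖x t (j, i)‖ ^ 2 ∂unitVol := by
    refine Real.sq_sqrt (integral_nonneg_of_ae ?_)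
    filter_upwards [nn] with t ht
    exact Finset.sum_nonneg fun j _ => Finset.sum_nonneg fun i _ => ht j i
  rw [he, le_div_iff₀ hm, mul_comm, ← integral_const_mul]
  refine integral_mono_ae ((hx j i).const_mul m)
    (integrable_finsetSum _ fun j _ => integrable_finsetSum _ fun i _ => hHx j i) ?_
  filter_upwards [nn, ae_restrict_mem measurableSet_Ioo] with t ht htI
  have h1 := (hH j i).lower t (Ioo_subset_Icc_self htI)
  calc m * ‖x t (j, i)‖ ^ 2 ≤ c.H j i t * ‖x t (j, i)‖ ^ 2 := by gcongr
    _ ≤ ∑ i, c.H j i t * ‖x t (j, i)‖ ^ 2 :=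
      Finset.single_le_sum (f := fun i => c.H j i t * ‖x t (j, i)‖ ^ 2)
        (fun i _ => ht j i) (Finset.mem_univ i)
    _ ≤ _ := Finset.single_le_sum (f := fun j => ∑ i, c.H j i t * ‖x t (j, i)‖ ^ 2)
        (fun j _ => Finset.sum_nonneg fun i _ => ht j i) (Finset.mem_univ j)

/-- The real state obtained from `𝓗 x` by a real functional `l` after rotating the moment by `ω`. -/
noncomputable def toState (x : c.maxDomain) (F : BeamSpace n) (l : ℂ →L[ℝ] ℝ) (ω : ℂ)
    (j : Fin (n + 1)) : BeamState where
  v t := l (c.effort x j 0 t)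
  v1 t := l (c.effort₁ x j 0 t)
  N t := l (ω * c.effort x j 1 t)
  N1 t := l (ω * c.effort₁ x j 1 t)
  g t := l ((c.len j : ℂ) ^ 2 * F t (j, 1))
  f t := l (-(ω * (c.len j : ℂ) ^ 2) * F t (j, 0))

theorem map_ofReal_mul (l : ℂ →L[ℝ] ℝ) (y : ℝ) (w : ℂ) : l ((y : ℂ) * w) = y * l w := by
  rw [← Complex.real_smul, map_smul, smul_eq_mul]

/-- Since β = σs², σ² = 1 and (iσ)² = -1, rotating the moment by iσ leaves real coefficients of the
same sign in both equations, and these commute with the real-linear `l`. -/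
theorem isMode_toState {m K : ℝ} {H' : Fin (n + 1) → Fin 2 → ℝ → ℝ} (hm : 0 < m)
    (hH : ∀ j i, IsCoef m K (c.H j i) (H' j i)) (x : c.maxDomain) (F : BeamSpace n) {β σ s : ℝ}
    (hF : F = c.maxOp x - (Complex.I * (β : ℂ)) • (x : BeamSpace n)) (hσ : σ * σ = 1)
    (hβ : β = σ * s ^ 2) (l : ℂ →L[ℝ] ℝ) (j : Fin (n + 1)) :
    (toState x F l (Complex.I * σ) j).IsMode (fun t => c.len j ^ 2 * (c.H j 1 t)⁻¹)
      (fun t => c.len j ^ 2 * (c.H j 0 t)⁻¹) s := by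
  have hx := c.isEffort x
  have hl := c.len_pos j
  have hFt : ∀ᵐ t ∂unitVol, ∀ i, F t (j, i) = c.opFun x t (j, i)
      - Complex.I * (β : ℂ) * (x : BeamSpace n) t (j, i) := by
    have h1 : (c.maxOp x : BeamSpace n) = (c.memLp_opFun x).toLp (c.opFun x) := rfl
    rw [hF]
    filter_upwards [Lp.coeFn_sub (c.maxOp x) ((Complex.I * (β : ℂ)) • (x : BeamSpace n)),
      Lp.coeFn_smul (Complex.I * (β : ℂ)) (x : BeamSpace n),
      MemLp.coeFn_toLp (c.memLp_opFun x)] with t e1 e2 e3 i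
    rw [e1, Pi.sub_apply, e2, h1, e3]
    simp
  have hH0 : ∀ᵐ t ∂unitVol, ∀ i, (c.H j i t : ℂ) ≠ 0 := by
    filter_upwards [ae_restrict_mem measurableSet_Ioo] with t ht i
    have := (hH j i).lower t (Ioo_subset_Icc_self ht)
    exact_mod_cast (by linarith : 0 < c.H j i t).ne'
  have hσ' : (σ : ℂ) * σ = 1 := by exact_mod_cast hσ
  have hl' : (c.len j : ℂ) ≠ 0 := by exact_mod_cast hl.ne'
  refine ⟨(hx.first j 0).acDeriv l, ((hx.second j 0).acDeriv l).congr ?_,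
    ((hx.first j 1).const_mul _).acDeriv l, (((hx.second j 1).const_mul _).acDeriv l).congr ?_,
    l.comp_memLp' ((memLp_coord F j 1).const_mul _),
    l.comp_memLp' ((memLp_coord F j 0).const_mul _)⟩
  · filter_upwards [hFt, hH0, hx.ae_eq j 1] with t h1 h2 h3
    simp only [toState]
    rw [← mul_assoc, ← map_ofReal_mul, ← map_add, h3, h1]
    congr 1
    simp only [opFun, Matrix.cons_val_one, Matrix.cons_val_fin_one, hβ]
    push_cast
    have := h2 1
    field_simp
    ring
  · filter_upwards [hFt, hH0, hx.ae_eq j 0] with t h1 h2 h3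
    simp only [toState]
    rw [← mul_assoc, ← map_ofReal_mul, ← map_add, h3, h1]
    congr 1
    simp only [opFun, Matrix.cons_val_zero, hβ]
    push_cast
    have := h2 0
    field_simp
    linear_combination (-(σ : ℂ) ^ 2 * (c.len j : ℂ) ^ 2 * s ^ 2 * (x : BeamSpace n) t (j, 0)) *
      Complex.I_sq + ((c.len j : ℂ) ^ 2 * s ^ 2 * (x : BeamSpace n) t (j, 0)) * hσ'

theorem integral_sq_map_le {w : ℝ → ℂ} (hw : MemLp w 2 unitVol) {l : ℂ →L[ℝ] ℝ}
    (hl : ∀ z, |l z| ≤ ‖z‖) (q : ℂ) :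
    ∫ t, l (q * w t) ^ 2 ∂unitVol ≤ ‖q‖ ^ 2 * ∫ t, ‖w t‖ ^ 2 ∂unitVol := by
  rw [← integral_const_mul]
  refine integral_mono (l.comp_memLp' (hw.const_mul q)).integrable_sq
    ((hw.integrable_norm_pow (by simp)).const_mul _) fun t => ?_
  simp only
  rw [← mul_pow, ← norm_mul, ← sq_abs]
  gcongr
  exact hl _

theorem memLp_effort (x : c.maxDomain) (j : Fin (n + 1)) (i : Fin 2) :
    MemLp (c.effort x j i) 2 unitVol := by
  have hc := ((c.isEffort x).first j i).continuousOn
  obtain ⟨C, hC⟩ := isCompact_Icc.exists_bound_of_continuousOn hc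
  refine MemLp.of_bound
    ((hc.integrableOn_Icc.mono_set Ioo_subset_Icc_self).aestronglyMeasurable) C ?_
  filter_upwards [ae_restrict_mem measurableSet_Ioo] with t ht
  exact hC t (Ioo_subset_Icc_self ht)

theorem integral_effort_bounds {m K : ℝ} {H' : Fin (n + 1) → Fin 2 → ℝ → ℝ} (hm : 0 < m)
    (hH : ∀ j i, IsCoef m K (c.H j i) (H' j i)) (x : c.maxDomain) (j : Fin (n + 1)) (i : Fin 2) :
    ∫ t, ‖c.effort x j i t‖ ^ 2 ∂unitVol ≤
        K ^ 2 * ∫ t, ‖(x : BeamSpace n) t (j, i)‖ ^ 2 ∂unitVol ∧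
      m ^ 2 * ∫ t, ‖(x : BeamSpace n) t (j, i)‖ ^ 2 ∂unitVol ≤
        ∫ t, ‖c.effort x j i t‖ ^ 2 ∂unitVol := by
  have i1 := (memLp_effort x j i).integrable_norm_pow (p := 2) (by simp)
  have i2 := (memLp_coord (x : BeamSpace n) j i).integrable_norm_pow (p := 2) (by simp)
  have h : ∀ᵐ t ∂unitVol, ‖c.effort x j i t‖ ^ 2 ≤ K ^ 2 * ‖(x : BeamSpace n) t (j, i)‖ ^ 2 ∧
      m ^ 2 * ‖(x : BeamSpace n) t (j, i)‖ ^ 2 ≤ ‖c.effort x j i t‖ ^ 2 := by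
    filter_upwards [(c.isEffort x).ae_eq j i, ae_restrict_mem measurableSet_Ioo] with t h1 ht
    have l := (hH j i).lower t (Ioo_subset_Icc_self ht)
    have u := (hH j i).upper t (Ioo_subset_Icc_self ht)
    rw [h1, norm_mul, Complex.norm_real, Real.norm_eq_abs, abs_of_pos (by linarith), mul_pow]
    constructor <;> gcongr
    linarith
  rw [← integral_const_mul, ← integral_const_mul]
  exact ⟨integral_mono_ae i1 (i2.const_mul _) (h.mono fun _ ht => ht.1),
    integral_mono_ae (i2.const_mul _) i1 (h.mono fun _ ht => ht.2)⟩

end BeamChain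

/-! ### Vanishing jumps and the conclusion. -/

namespace BeamChain

variable {n : ℕ} {c : BeamChain n}

/-- An element of `D(𝔄₀)` as an element of `D(𝔄)`. -/
noncomputable def toMax (x : c.op₀.domain) : c.maxDomain := Submodule.inclusion c.domain₀_le x

theorem junctionB₀_toMax (x : c.op₀.domain) (k : Fin n) : c.junctionB₀ k (toMax x) = 0 := by
  obtain ⟨y, hy, hyx⟩ := x.2
  have : toMax x = y := Subtype.ext hyx.symm
  rw [this]
  exact (Submodule.mem_iInf _).1 hy k

/-- All four jumps vanish asymptotically. -/
theorem tendsto_jumps {x : ℕ → c.op₀.domain} (hB : Tendsto (fun k => c.B (x k)) atTop (𝓝 0))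
    (k : Fin n) : ∀ i : Fin 2, Tendsto (fun q => c.jumpVal k i (toMax (x q))) atTop (𝓝 0) ∧
      Tendsto (fun q => c.jumpDer k i (toMax (x q))) atTop (𝓝 0) := by
  have h1 : Tendsto (fun q => c.junctionB k (toMax (x q))) atTop (𝓝 0) :=
    ((continuous_apply k).comp (continuous_fst.comp continuous_snd)).continuousAt.tendsto.comp hB
  have h0 : Tendsto (fun q => c.junctionB₀ k (toMax (x q))) atTop (𝓝 0) := by
    simp [junctionB₀_toMax]
  have e1 := tendsto_pi_nhds.1 h1
  have e0 := tendsto_pi_nhds.1 h0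
  have neg : ∀ {f : ℕ → ℂ}, Tendsto (fun q => -f q) atTop (𝓝 0) → Tendsto f atTop (𝓝 0) :=
    fun hf => by simpa using hf.neg
  unfold junctionB at e1
  unfold junctionB₀ at e0
  -- In each case the two maps together list all four jumps, two of which are exactly zero on D(𝔄₀);
  -- the cases merely sort them.
  cases hk : c.junction k <;> simp only [hk] at e0 e1 <;>
    have a0 := e0 0 <;> have a1 := e0 1 <;> have b0 := e1 0 <;> have b1 := e1 1 <;>
    simp at a0 a1 b0 b1 <;> intro i <;> fin_cases i
  · exact ⟨a0, a1⟩
  · exact ⟨b1, neg b0⟩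
  · exact ⟨a0, b1⟩
  · exact ⟨a1, neg b0⟩
  · exact ⟨b0, a1⟩
  · exact ⟨b1, neg a0⟩
  · exact ⟨b0, b1⟩
  · exact ⟨a1, neg a0⟩

theorem tendsto_norm_zero_of_tendsto_integral_effort {m K : ℝ}
    {H' : Fin (n + 1) → Fin 2 → ℝ → ℝ} (hm : 0 < m)
    (hH : ∀ j i, IsCoef m K (c.H j i) (H' j i)) {x : ℕ → c.maxDomain}
    (h : ∀ j i, Tendsto (fun k => ∫ t, ‖c.effort (x k) j i t‖ ^ 2 ∂unitVol) atTop (𝓝 0)) :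
    Tendsto (fun k => ‖(x k : BeamSpace n)‖) atTop (𝓝 0) := by
  have h1 : ∀ p : Fin (n + 1) × Fin 2,
      Tendsto (fun k => ∫ t, ‖(x k : BeamSpace n) t p‖ ^ 2 ∂unitVol) atTop (𝓝 0) := by
    intro p
    have := (h p.1 p.2).div_const (m ^ 2)
    rw [zero_div] at this
    refine squeeze_zero (fun k => integral_nonneg fun t => sq_nonneg _) (fun k => ?_) this
    rw [le_div_iff₀ (by positivity), mul_comm]
    exact (integral_effort_bounds hm hH (x k) p.1 p.2).2
  have h2 := tendsto_finsetSum Finset.univ fun p _ => h1 p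
  simp only [← norm_sq_eq, Finset.sum_const_zero] at h2
  have h3 := h2.sqrt
  simpa using h3

/-- Asymptotic decay of the real states obtained from a functional bounded by the norm. -/
theorem tendsto_integral_map_effort (hR : c.Regular) (hM : c.JumpCondition)
    {a b d : Bool} {x : ℕ → c.op₀.domain} {β : ℕ → ℝ}
    (hx : ∃ C : ℝ, ∀ k, c.energyNorm (x k) ≤ C)
    (hβ : Tendsto (fun k => |β k|) atTop atTop)
    (hA : Tendsto (fun k => c.energyNorm
      (c.op₀ (x k) - (Complex.I * (β k : ℂ)) • (x k : BeamSpace n))) atTop (𝓝 0))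
    (hRx : Tendsto (fun k => c.R a b d (x k)) atTop (𝓝 0))
    (hBx : Tendsto (fun k => c.B (x k)) atTop (𝓝 0))
    {σ : ℕ → ℝ} (hσ : ∀ k, |σ k| = 1) (hσβ : ∀ k, β k = σ k * |β k|)
    {l : ℂ →L[ℝ] ℝ} (hl : ∀ z, |l z| ≤ ‖z‖) (j : Fin (n + 1)) :
    Tendsto (fun k => ∫ t, l (c.effort (toMax (x k)) j 0 t) ^ 2 ∂unitVol
      + ∫ t, l (Complex.I * σ k * c.effort (toMax (x k)) j 1 t) ^ 2 ∂unitVol) atTop (𝓝 0) := by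
  obtain ⟨C, hC⟩ := hx
  -- Two pairs of constants are needed: `m₁`, `K₁` for the entries of 𝓗, to compare norms, and `m`,
  -- `K` for the coefficients h²/𝓗 of the real system.
  obtain ⟨m₁, hm₁, -, K₁, hK₁⟩ := IsLipPos.exists_uniform
    (F := fun p : Fin (n + 1) × Fin 2 => c.H p.1 p.2) fun p => hR.isLipPos_H p.1 p.2
  obtain ⟨m, hm, hm1, K, hK⟩ := IsLipPos.exists_uniform
    (F := fun (p : Fin (n + 1) × Fin 2) t => c.len p.1 ^ 2 * (c.H p.1 p.2 t)⁻¹)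
    fun p => (hR.isLipPos_H p.1 p.2).inv.const_mul (pow_pos (c.len_pos p.1) 2)
  have hH : ∀ j i, IsCoef m₁ K₁ (c.H j i) (deriv (c.H j i)) := fun j i => hK₁ (j, i)
  set F : ℕ → BeamSpace n := fun k =>
    c.op₀ (x k) - (Complex.I * (β k : ℂ)) • (x k : BeamSpace n) with hF
  have hFmax : ∀ k, F k = c.maxOp (toMax (x k))
      - (Complex.I * (β k : ℂ)) • (toMax (x k) : BeamSpace n) := fun _ => rfl
  set s : ℕ → ℝ := fun k => √|β k| with hs
  have hs2 : ∀ k, s k ^ 2 = |β k| := fun k => Real.sq_sqrt (abs_nonneg _)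
  set u : ℕ → Fin (n + 1) → BeamState := fun k j =>
    toState (toMax (x k)) (F k) l (Complex.I * σ k) j with hu
  have hσ2 : ∀ k, σ k * σ k = 1 := fun k => by rw [← abs_mul_abs_self, hσ k, one_mul]
  have hω : ∀ k, ‖Complex.I * (σ k : ℂ)‖ = 1 := fun k => by simp [hσ k]
  have hl4 : ∀ j, c.len j ^ 4 ≤ ∑ j, c.len j ^ 4 := fun j =>
    Finset.single_le_sum (f := fun j => c.len j ^ 4)
      (fun j _ => pow_nonneg (c.len_pos j).le 4) (Finset.mem_univ j)
  have rhs_le : ∀ k j,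
      ∫ t, (u k j).g t ^ 2 ∂unitVol ≤ c.len j ^ 4 * (c.energyNorm (F k) ^ 2 / m₁) ∧
      ∫ t, (u k j).f t ^ 2 ∂unitVol ≤ c.len j ^ 4 * (c.energyNorm (F k) ^ 2 / m₁) := by
    intro k j
    have hlj := c.len_pos j
    have q1 : ‖(c.len j : ℂ) ^ 2‖ ^ 2 = c.len j ^ 4 := by
      rw [norm_pow, Complex.norm_real, Real.norm_eq_abs, abs_of_pos hlj]; ring
    have q2 : ‖-(Complex.I * (σ k : ℂ) * (c.len j : ℂ) ^ 2)‖ ^ 2 = c.len j ^ 4 := by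
      rw [norm_neg, norm_mul, hω, one_mul, q1]
    have e1 := integral_sq_map_le (memLp_coord (F k) j 1) hl ((c.len j : ℂ) ^ 2)
    have e2 := integral_sq_map_le (memLp_coord (F k) j 0) hl
      (-(Complex.I * (σ k : ℂ) * (c.len j : ℂ) ^ 2))
    rw [q1] at e1
    rw [q2] at e2
    exact ⟨e1.trans (by gcongr; exact integral_norm_sq_le hm₁ hH _ _ _),
      e2.trans (by gcongr; exact integral_norm_sq_le hm₁ hH _ _ _)⟩
  have val_le : ∀ k j i (ω : ℂ), ‖ω‖ = 1 →
      ∫ t, l (ω * c.effort (toMax (x k)) j i t) ^ 2 ∂unitVol ≤ K₁ ^ 2 * (C ^ 2 / m₁) := by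
    intro k j i ω hω1
    have e1 := integral_sq_map_le (memLp_effort (toMax (x k)) j i) hl ω
    rw [hω1, one_pow, one_mul] at e1
    refine e1.trans ((integral_effort_bounds hm₁ hH (toMax (x k)) j i).1.trans ?_)
    gcongr
    refine (integral_norm_sq_le hm₁ hH _ j i).trans ?_
    gcongr
    · exact Real.sqrt_nonneg _
    · exact hC k
  have hEsq : Tendsto (fun k => c.energyNorm (F k) ^ 2 / m₁) atTop (𝓝 0) := by
    simpa using (hA.pow 2).div_const m₁
  have apply_l : ∀ {w : ℕ → ℂ} (ω : ℕ → ℂ), (∀ k, ‖ω k‖ = 1) → Tendsto w atTop (𝓝 0) →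
      Tendsto (fun k => l (ω k * w k)) atTop (𝓝 0) := by
    intro w ω hω1 hw
    refine squeeze_zero_norm (fun k => (hl _).trans (le_of_eq ?_))
      (tendsto_zero_iff_norm_tendsto_zero.1 hw)
    rw [norm_mul, hω1, one_mul]
  have apply_l1 : ∀ {w : ℕ → ℂ}, Tendsto w atTop (𝓝 0) →
      Tendsto (fun k => l (w k)) atTop (𝓝 0) := fun hw => by
    simpa using apply_l (fun _ => 1) (fun _ => by simp) hw
  have l_der : ∀ (ω w : ℂ) (j : Fin (n + 1)),
      l (ω * ((c.len j : ℂ)⁻¹ * w)) = l (ω * w) / c.len j := fun ω w j => by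
    rw [mul_left_comm, ← Complex.ofReal_inv, map_ofReal_mul, div_eq_inv_mul]
  have l_der1 : ∀ (w : ℂ) (j : Fin (n + 1)),
      l ((c.len j : ℂ)⁻¹ * w) = l w / c.len j := fun w j => by
    simpa using l_der 1 w j
  have of_der : ∀ {w : ℕ → ℂ} (j : Fin (n + 1)),
      Tendsto (fun k => (c.len j : ℂ)⁻¹ * w k) atTop (𝓝 0) → Tendsto w atTop (𝓝 0) := by
    intro w j hw
    have hne : (c.len j : ℂ) ≠ 0 := by exact_mod_cast (c.len_pos j).ne'
    have := hw.const_mul (c.len j : ℂ)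
    rw [mul_zero] at this
    exact this.congr fun k => mul_inv_cancel_left₀ hne _
  have hRc := tendsto_pi_nhds.1 hRx
  have r0 : Tendsto (fun k => c.effort (toMax (x k)) 0 0 0) atTop (𝓝 0) := hRc 0
  have r1 : Tendsto (fun k => c.effort (toMax (x k)) 0 1 0) atTop (𝓝 0) := hRc 1
  have r2 : Tendsto (fun k => (if a then c.der 0 0 0 else c.der 0 1 0) (toMax (x k)))
    atTop (𝓝 0) := hRc 2
  have r3 : Tendsto (fun k => (if b then c.val (Fin.last n) 0 1 else c.der (Fin.last n) 1 1)
    (toMax (x k))) atTop (𝓝 0) := hRc 3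
  have r4 : Tendsto (fun k => (if d then c.der (Fin.last n) 0 1 else c.val (Fin.last n) 1 1)
    (toMax (x k))) atTop (𝓝 0) := hRc 4
  have jump : ∀ (k : Fin n) (i : Fin 2), c.H k.castSucc i 1 ≤ c.H k.succ i 0 := by
    intro k i
    have := (hM k).diag_nonneg (i := i)
    simpa [HMat] using this
  -- Inversion reverses the jump condition, and the factor h² of the coefficients cancels against
  -- the scaling of the flux.
  have jumpCoef : ∀ (k : Fin n) (i : Fin 2),
      c.len k.succ ^ 2 * (c.H k.succ i 0)⁻¹ / stepLen c.node k.succ ^ 2 ≤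
        c.len k.castSucc ^ 2 * (c.H k.castSucc i 1)⁻¹ / stepLen c.node k.castSucc ^ 2 := by
    intro k i
    have e : ∀ (j : Fin (n + 1)) (y : ℝ), c.len j ^ 2 * y / stepLen c.node j ^ 2 = y := by
      intro j y
      have h1 : stepLen c.node j = c.len j := rfl
      have h2 := (c.len_pos j).ne'
      rw [h1]
      field_simp
    rw [e, e]
    have h1 := (hH k.castSucc i).lower 1 (by simp)
    have := jump k i
    gcongr
    linarith
  -- The bound adds one constant for v, N and one for g, f; the latter is valid as soon as the
  -- squared energy norm of the residual is at most `m₁`.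
  have chain : IsApproxChain c.node (fun j t => c.len j ^ 2 * (c.H j 1 t)⁻¹)
      (fun j => deriv fun t => c.len j ^ 2 * (c.H j 1 t)⁻¹)
      (fun j t => c.len j ^ 2 * (c.H j 0 t)⁻¹)
      (fun j => deriv fun t => c.len j ^ 2 * (c.H j 0 t)⁻¹) m K
      (K₁ ^ 2 * (C ^ 2 / m₁) + (∑ j, c.len j ^ 4) * 1) s u :=
    { mono := c.node_strictMono
      pos := hm
      le_one := hm1
      coefA := fun j => hK (j, 1)
      coefR := fun j => hK (j, 0)
      jumpA := fun k => jumpCoef k 1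
      jumpR := fun k => jumpCoef k 0
      freq := Real.tendsto_sqrt_atTop.comp hβ
      mode := fun k j => isMode_toState hm₁ hH (toMax (x k)) (F k) (hFmax k) (hσ2 k)
        (by rw [hs2]; exact hσβ k) l j
      bounded := by
        filter_upwards [hEsq.eventually (ge_mem_nhds one_pos)] with k hk j
        have h4 : 0 ≤ ∑ j, c.len j ^ 4 :=
          Finset.sum_nonneg fun j _ => pow_nonneg (c.len_pos j).le 4
        have hb : 0 ≤ K₁ ^ 2 * (C ^ 2 / m₁) := by positivity
        have hr : c.len j ^ 4 * (c.energyNorm (F k) ^ 2 / m₁) ≤ (∑ j, c.len j ^ 4) * 1 := by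
          gcongr
          exact hl4 j
        have hv := val_le k j 0 1 (by simp)
        simp only [one_mul] at hv
        exact ⟨hv.trans (by linarith), (val_le k j 1 _ (hω k)).trans (by linarith),
          (rhs_le k j).1.trans (by linarith), (rhs_le k j).2.trans (by linarith)⟩
      rhs := fun j => by
        have lim := (hEsq.const_mul (c.len j ^ 4)).add (hEsq.const_mul (c.len j ^ 4))
        rw [mul_zero, add_zero] at lim
        exact squeeze_zero (fun k => add_nonneg (integral_nonneg fun _ => sq_nonneg _)
          (integral_nonneg fun _ => sq_nonneg _))
          (fun k => add_le_add (rhs_le k j).1 (rhs_le k j).2) lim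
      jumpV := fun k => (apply_l1 (tendsto_jumps hBx k 0).1).congr fun q => map_sub l _ _
      jumpN := fun k => (apply_l _ hω (tendsto_jumps hBx k 1).1).congr fun q => by
        change l (_ * (c.effort _ _ _ _ - c.effort _ _ _ _)) = _
        rw [mul_sub, map_sub]
        rfl
      jumpV1 := fun k => (apply_l1 (tendsto_jumps hBx k 0).2).congr fun q => by
        change l ((c.len _ : ℂ)⁻¹ * _ - (c.len _ : ℂ)⁻¹ * _) = _
        rw [map_sub, l_der1, l_der1]
        rfl
      jumpN1 := fun k => (apply_l _ hω (tendsto_jumps hBx k 1).2).congr fun q => by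
        change l (_ * ((c.len _ : ℂ)⁻¹ * _ - (c.len _ : ℂ)⁻¹ * _)) = _
        rw [mul_sub, map_sub, l_der, l_der]
        rfl
      leftV := apply_l1 r0
      leftN := apply_l _ hω r1
      left := by
        cases a
        · exact .inr (apply_l _ hω (of_der 0 r2))
        · exact .inl (apply_l1 (of_der 0 r2))
      right := by
        cases b
        · exact .inr (apply_l _ hω (of_der (Fin.last n) r3))
        · exact .inl (apply_l1 r3)
      right' := by
        cases d
        · exact .inr (apply_l _ hω r4)
        · exact .inl (apply_l1 (of_der (Fin.last n) r4)) }
  exact chain.tendsto_integral j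

end BeamChain

theorem proposition3p6 {n : ℕ} (c : BeamChain n) (hR : c.Regular) (hM : c.JumpCondition)
    (a b d : Bool) (x : ℕ → c.op₀.domain) (β : ℕ → ℝ)
    (hx : ∃ C : ℝ, ∀ k, c.energyNorm (x k) ≤ C)
    (hβ : Tendsto (fun k => |β k|) atTop atTop)
    (hA : Tendsto (fun k => c.energyNorm (c.op₀ (x k) - (Complex.I * (β k : ℂ)) • (x k : BeamSpace n)))
      atTop (𝓝 0))
    (hRx : Tendsto (fun k => c.R a b d (x k)) atTop (𝓝 0))
    (hBx : Tendsto (fun k => c.B (x k)) atTop (𝓝 0)) :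
    Tendsto (fun k => ‖(x k : BeamSpace n)‖) atTop (𝓝 0) := by
  obtain ⟨m, hm, -, K, hK⟩ := IsLipPos.exists_uniform
    (F := fun p : Fin (n + 1) × Fin 2 => c.H p.1 p.2) fun p => hR.isLipPos_H p.1 p.2
  -- The value 1 at β = 0 ensures |σ| = 1 for every index, not only eventually.
  set σ : ℕ → ℝ := fun k => if 0 ≤ β k then 1 else -1 with hσd
  have hσ : ∀ k, |σ k| = 1 := fun k => by
    simp only [hσd]; split_ifs <;> simp
  have hσβ : ∀ k, β k = σ k * |β k| := fun k => by
    simp only [hσd]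
    split_ifs with h
    · rw [abs_of_nonneg h, one_mul]
    · rw [abs_of_neg (not_le.1 h)]; ring
  refine BeamChain.tendsto_norm_zero_of_tendsto_integral_effort (x := fun k => BeamChain.toMax (x k))
    hm (fun j i => hK (j, i)) fun j i => ?_
  have hre := BeamChain.tendsto_integral_map_effort hR hM hx hβ hA hRx hBx hσ hσβ
    (l := Complex.reCLM) Complex.abs_re_le_norm j
  have him := BeamChain.tendsto_integral_map_effort hR hM hx hβ hA hRx hBx hσ hσβ
    (l := Complex.imCLM) Complex.abs_im_le_norm j
  -- A unimodular rotation preserves the modulus, so the decay of both parts of the rotated moment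
  -- gives the decay of the moment itself.
  have split : ∀ k i (ω : ℂ), ‖ω‖ = 1 →
      ∫ t, ‖c.effort (BeamChain.toMax (x k)) j i t‖ ^ 2 ∂unitVol =
      ∫ t, Complex.reCLM (ω * c.effort (BeamChain.toMax (x k)) j i t) ^ 2 ∂unitVol +
      ∫ t, Complex.imCLM (ω * c.effort (BeamChain.toMax (x k)) j i t) ^ 2 ∂unitVol := by
    intro k i ω hω
    have hw := (BeamChain.memLp_effort (BeamChain.toMax (x k)) j i).const_mul ω
    refine Eq.trans ?_ (integral_add (Complex.reCLM.comp_memLp' hw).integrable_sq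
      (Complex.imCLM.comp_memLp' hw).integrable_sq)
    congr 1
    ext t
    rw [← one_mul ‖_‖, ← hω, ← norm_mul, Complex.sq_norm, Complex.normSq_apply]
    simp only [Complex.reCLM_apply, Complex.imCLM_apply]
    ring
  have lim := hre.add him
  rw [add_zero] at lim
  have nn : ∀ f : ℝ → ℝ, 0 ≤ ∫ t, f t ^ 2 ∂unitVol := fun f => integral_nonneg fun _ => sq_nonneg _
  refine squeeze_zero (fun k => integral_nonneg fun _ => sq_nonneg _) (fun k => ?_) lim
  have n1 := nn fun t => Complex.reCLM (c.effort (BeamChain.toMax (x k)) j 0 t)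
  have n2 := nn fun t => Complex.imCLM (c.effort (BeamChain.toMax (x k)) j 0 t)
  have n3 := nn fun t => Complex.reCLM (Complex.I * σ k * c.effort (BeamChain.toMax (x k)) j 1 t)
  have n4 := nn fun t => Complex.imCLM (Complex.I * σ k * c.effort (BeamChain.toMax (x k)) j 1 t)
  fin_cases i
  · have h := split k 0 1 (by simp)
    simp only [one_mul] at h
    refine h.le.trans ?_
    linarith
  · have h := split k 1 (Complex.I * σ k) (by simp [hσ k])
    refine h.le.trans ?_
    linarith
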